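/- Let $N\ge 1$ and let $\mathcal G$ be the star graph made of $N$ half-lines $\mathbb R^+=[0,\infty)$ glued at the origin. A function $\Phi:\mathcal G\to\mathbb C$ is a tuple $(\phi_1,\dots,\phi_N)$ of functions on $\mathbb R^+$, with $\|\Phi\|_p^p=\sum_j\|\phi_j\|_{L^p(\mathbb R^+)}^p$ for $1\le p<\infty$, $\|\Phi\|_\infty=\max_j\|\phi_j\|_{L^\infty(\mathbb R^+)}$ and $\|\cdot\|=\|\cdot\|_2$; $L^p(\mathcal G)$ is the space of $\Phi$ with all $\phi_j\in L^p(\mathbb R^+)$. The energy space is $$\mathcal E=\{\Phi : \phi_j\in H^1(\mathbb R^+)\ (1\le j\le N),\ \phi_1(0)=\dots=\phi_N(0)\},$$ where $H^1$ functions are identified with their continuous representatives, and $\Phi'=(\phi_1',\dots,\phi_N')$ with weak derivatives. Put $\lambda(s)=\sum_{j}|\{x\in\mathbb R^+: |\phi_j(x)|\ge s\}|$ and $g(t)=\sup\{s : \lambda(s)>Nt\}$ for $t\geq 0$. The symmetric decreasing rearrangement of $\Phi$ is $\Phi^*=(g,\dots,g)$. 1. If $1\le p\le\infty$ and $\Phi\in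 L^p(\mathcal G)$, then $\Phi^*$ is nonnegative, symmetric (all components are equal) and nonincreasing on $(0,\infty)$, $\Phi^*\in L^p(\mathcal G)$ and $\|\Phi^*\|_p=\|\Phi\|_p$. 2. If $\Phi\in\mathcal E$, then $\Phi^*\in\mathcal E$. 3. If $N\ge2$, then $\|(\Phi^*)'\|\le\frac N2\|\Phi'\|$ for all $\Phi\in\mathcal E$, and the constant $\frac N2$ is optimal: if $C\ge 0$ is such that $\|(\Phi^*)'\|\le C\|\Phi'\|$ for all $\Phi\in\mathcal E$, then $C\ge \frac N2$. -/

import Mathlib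

open MeasureTheory Set
open scoped ENNReal ContDiff

namespace StarGraph

/-- Lebesgue measure on the half-line `ℝ⁺`. A function on the star graph with `N` edges is a
family `Φ : Fin N → ℝ → E`, of which only the values `Φ j x` with `0 ≤ x` matter; the points
`x = 0` of the edges are glued together to form the vertex. -/
noncomputable def halfLine : Measure ℝ := volume.restrict (Ioi 0)

section Norms

variable {E : Type*} [NormedAddCommGroup E] {N : ℕ}

/-- `Φ ∈ L^p(𝒢)`: every component is in `L^p(ℝ⁺)`. -/
def MemLpGraph (Φ : Fin N → ℝ → E) (p : ℝ≥0∞) : Prop :=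
  ∀ j, MemLp (Φ j) p halfLine

open scoped Classical in
/-- The `L^p(𝒢)` norm: `‖Φ‖_p ^ p = ∑ j, ‖φ_j‖_p ^ p` for finite `p`, and
`‖Φ‖_∞ = max_j ‖φ_j‖_∞`. -/
noncomputable def graphNorm (Φ : Fin N → ℝ → E) (p : ℝ≥0∞) : ℝ≥0∞ :=
  if p = ⊤ then ⨆ j, eLpNorm (Φ j) ⊤ halfLine
  else (∑ j, eLpNorm (Φ j) p halfLine ^ p.toReal) ^ (1 / p.toReal)

/-- `λ(s) = |{ |Φ| ≥ s }|`, the total length of the superlevel set in the graph. -/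
noncomputable def levelMeasure (Φ : Fin N → ℝ → E) (s : ℝ) : ℝ≥0∞ :=
  ∑ j, halfLine {x | s ≤ ‖Φ j x‖}

/-- `g(t) = sup { s | λ(s) > N t }`. -/
noncomputable def profile (Φ : Fin N → ℝ → E) (t : ℝ) : ℝ :=
  sSup {s : ℝ | (N : ℝ≥0∞) * ENNReal.ofReal t < levelMeasure Φ s}

/-- The symmetric decreasing rearrangement `Φ*`, equal to `g` on each edge. -/
noncomputable def rearrangement (Φ : Fin N → ℝ → E) : Fin N → ℝ → ℝ :=
  fun _ x => profile Φ x

end Norms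

section Sobolev

variable {E : Type*} [NormedAddCommGroup E] [NormedSpace ℝ E] {N : ℕ}

/-- `v` is a weak derivative of `u` on the open half-line `(0, ∞)`. -/
structure HasWeakDeriv (u v : ℝ → E) : Prop where
  locallyIntegrable : LocallyIntegrableOn u (Ioi 0)
  locallyIntegrable_deriv : LocallyIntegrableOn v (Ioi 0)
  integral_eq : ∀ χ : ℝ → ℝ, ContDiff ℝ ∞ χ → HasCompactSupport χ → tsupport χ ⊆ Ioi 0 →
    ∫ x, deriv χ x • u x ∂halfLine = - ∫ x, χ x • v x ∂halfLine

open scoped Classical in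
/-- The weak derivative, which is unique up to null sets (and set to zero where it does not
exist). -/
noncomputable def weakDeriv (u : ℝ → E) : ℝ → E :=
  if h : ∃ v, HasWeakDeriv u v then h.choose else 0

/-- `u ∈ H¹(ℝ⁺)`: both `u` and its weak derivative are in `L²(ℝ⁺)`. -/
def MemH1 (u : ℝ → E) : Prop :=
  MemLp u 2 halfLine ∧ ∃ v, HasWeakDeriv u v ∧ MemLp v 2 halfLine

/-- The energy space `ℰ`: functions in `H¹(𝒢)` whose components take a common value at the
vertex. As usual in one dimension, an `H¹` function is given by its continuous representative on
`[0, ∞)`, so that the value at the vertex makes sense. -/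
structure MemEnergy (Φ : Fin N → ℝ → E) : Prop where
  memH1 : ∀ j, MemH1 (Φ j)
  continuousOn : ∀ j, ContinuousOn (Φ j) (Ici 0)
  vertex : ∀ i j, Φ i 0 = Φ j 0

/-- `Φ'`, taken componentwise. -/
noncomputable def graphDeriv (Φ : Fin N → ℝ → E) : Fin N → ℝ → E :=
  fun j => weakDeriv (Φ j)

end Sobolev

end StarGraph

/-! Everything rests on one integrated inequality, which replaces the coarea formula. Let g be the
profile, G(t) the part of ∫|Φ'|² carried by {|Φ| > g(t)}, and g(t) < c ≤ d < g(s) with s < t. The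
set {c < |Φ| < d} has total length at most N(t - s), by the definition of g. On it |Φ| passes from d
to c at least m times: always m = 1, since |Φ| comes down to c along every edge, and m = 2 if N ≥ 2,
because from a point where |Φ| ≥ d one can go outwards, or through the vertex and out along another
edge. Hence m(d - c) is at most the integral of |Φ'| over the band, and Cauchy–Schwarz followed by c
→ g(t), d → g(s) gives (g(s) - g(t))² ≤ (N/m²)(t - s)(G(t) - G(s)), which is `sq_profile_sub_le`.

Since G is monotone and bounded by ‖Φ'‖², this makes g absolutely continuous
(`absolutelyContinuousOnInterval_of_sq_sub_le`), so g has a weak derivative, namely its pointwise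
one. It also gives g'² ≤ (N/m²) G' almost everywhere, whence ∫ g'² ≤ (N/m²)‖Φ'‖²
(`lintegral_enorm_deriv_sq_le`). With m = 1 the energy space is preserved; with m = 2 the N copies
of g yield ‖(Φ*)'‖² ≤ (N²/4)‖Φ'‖².

The L^p statement is equimeasurability (`measure_lt_profile`): the norms depend only on the
distribution function. For optimality, a tent of height 1 on a single edge has ‖Φ'‖² ≤ 2, while g
falls from at least 1 to 0 over a length 2/N, which costs ∫ g'² ≥ N/2. -/

namespace StarGraph

open Filter Topology

/-! ### Weak derivatives: uniqueness and the fundamental theorem of calculus. -/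

section WeakDerivative

theorem integrableOn_Ioc_of_memLp {E : Type*} [NormedAddCommGroup E] {v : ℝ → E} (hv : MemLp v 2 halfLine) (z : ℝ) :
    IntegrableOn v (Ioc 0 z) := by
  have h : MemLp v 2 (volume.restrict (Ioc 0 z)) :=
    hv.mono_measure (Measure.restrict_mono Ioc_subset_Ioi_self le_rfl)
  exact h.integrable one_le_two

variable {E : Type*} [NormedAddCommGroup E] [NormedSpace ℝ E]

/-- The fundamental lemma of the calculus of variations. It frees `weakDeriv` from the arbitrary
choice in its definition. -/
theorem HasWeakDeriv.ae_eq [CompleteSpace E] {u v w : ℝ → E}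
    (hv : HasWeakDeriv u v) (hw : HasWeakDeriv u w) : v =ᵐ[halfLine] w := by
  have hint : ∀ f : ℝ → E, LocallyIntegrableOn f (Ioi 0) → ∀ χ : ℝ → ℝ, ContDiff ℝ ∞ χ →
      HasCompactSupport χ → tsupport χ ⊆ Ioi 0 → Integrable (fun x => χ x • f x) := by
    intro f hf χ h1 h2 h3
    have : IntegrableOn (fun x => χ x • f x) (tsupport χ) :=
      (hf.integrableOn_compact_subset h3 h2).continuousOn_smul h1.continuous.continuousOn h2
    refine (integrableOn_iff_integrable_of_support_subset ?_).1 this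
    exact (Function.support_smul_subset_left _ _).trans (subset_tsupport χ)
  have h := isOpen_Ioi.ae_eq_zero_of_integral_contDiff_smul_eq_zero (μ := volume)
    (hv.locallyIntegrable_deriv.sub hw.locallyIntegrable_deriv) (U := Ioi (0 : ℝ)) ?_
  · refine (ae_restrict_iff' measurableSet_Ioi).2 ?_
    filter_upwards [h] with x hx hx0
    exact sub_eq_zero.1 (hx hx0)
  · intro χ h1 h2 h3
    have key : ∀ f : ℝ → E, ∫ x, χ x • f x ∂halfLine = ∫ x, χ x • f x := by
      intro f
      refine setIntegral_eq_integral_of_forall_compl_eq_zero fun x hx => ?_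
      have : χ x = 0 := by
        by_contra hne
        exact hx (h3 (subset_tsupport χ hne))
      simp [this]
    have e : ∫ x, χ x • v x = ∫ x, χ x • w x := by
      rw [← key, ← key, ← neg_inj, ← hv.integral_eq χ h1 h2 h3, ← hw.integral_eq χ h1 h2 h3]
    simp only [Pi.sub_apply, smul_sub]
    rw [integral_sub (hint v hv.locallyIntegrable_deriv χ h1 h2 h3)
      (hint w hw.locallyIntegrable_deriv χ h1 h2 h3), e, sub_self]

theorem HasWeakDeriv.weakDeriv_ae_eq [CompleteSpace E] {u v : ℝ → E} (hv : HasWeakDeriv u v) :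
    weakDeriv u =ᵐ[halfLine] v := by
  have h : ∃ v, HasWeakDeriv u v := ⟨v, hv⟩
  have : weakDeriv u = h.choose := by simp only [weakDeriv, dif_pos h]
  rw [this]
  exact h.choose_spec.ae_eq hv

theorem HasWeakDeriv.ofReal {u v : ℝ → ℝ} (h : HasWeakDeriv u v) :
    HasWeakDeriv (fun x => (u x : ℂ)) (fun x => (v x : ℂ)) := by
  have hl : ∀ f : ℝ → ℝ, LocallyIntegrableOn f (Ioi 0) →
      LocallyIntegrableOn (fun x => (f x : ℂ)) (Ioi 0) := by
    intro f hf x hx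
    obtain ⟨s, hs, hi⟩ := hf x hx
    exact ⟨s, hs, hi.ofReal⟩
  refine ⟨hl u h.1, hl v h.2, fun χ h1 h2 h3 => ?_⟩
  have := congrArg (fun r : ℝ => (r : ℂ)) (h.integral_eq χ h1 h2 h3)
  simpa only [Complex.real_smul, smul_eq_mul, Complex.ofReal_neg, ← integral_complex_ofReal,
    Complex.ofReal_mul] using this

theorem deriv_smoothTransition_of_nonpos {x : ℝ} (hx : x ≤ 0) :
    deriv Real.smoothTransition x = 0 := by
  refine IsLocalMin.deriv_eq_zero (Eventually.of_forall fun y => ?_)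
  rw [Real.smoothTransition.zero_of_nonpos hx]
  exact Real.smoothTransition.nonneg y

theorem deriv_smoothTransition_of_one_le {x : ℝ} (hx : 1 ≤ x) :
    deriv Real.smoothTransition x = 0 := by
  refine IsLocalMax.deriv_eq_zero (Eventually.of_forall fun y => ?_)
  rw [Real.smoothTransition.one_of_one_le hx]
  exact Real.smoothTransition.le_one y

theorem continuous_deriv_smoothTransition : Continuous (deriv Real.smoothTransition) :=
  (Real.smoothTransition.contDiff (n := 1)).continuous_deriv le_rfl

theorem integral_deriv_smoothTransition_smul {u : ℝ → E} (y : ℝ) {ε : ℝ} (hε : 0 < ε) :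
    ∫ x, (ε⁻¹ * deriv Real.smoothTransition (ε⁻¹ * (x - y))) • u x =
      ∫ s in (0 : ℝ)..1, deriv Real.smoothTransition s • u (y + ε * s) := by
  have h1 : ∫ s in (0 : ℝ)..1, deriv Real.smoothTransition s • u (y + ε * s) =
      ∫ s, deriv Real.smoothTransition s • u (y + ε * s) := by
    refine intervalIntegral.integral_eq_integral_of_support_subset fun s hs => ?_
    have h0 : deriv Real.smoothTransition s ≠ 0 := fun h => hs (by simp [h])
    refine ⟨?_, ?_⟩
    · by_contra h; exact h0 (deriv_smoothTransition_of_nonpos (not_lt.1 h))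
    · by_contra h; exact h0 (deriv_smoothTransition_of_one_le (not_le.1 h).le)
  rw [h1]
  set h : ℝ → E := fun x => (deriv Real.smoothTransition (ε⁻¹ * (x - y))) • u x with hh
  have h2 : ∀ s, deriv Real.smoothTransition s • u (y + ε * s) = h (y + ε * s) := by
    intro s
    have : ε⁻¹ * (y + ε * s - y) = s := by field_simp; ring
    simp only [hh, this]
  simp_rw [h2]
  rw [Measure.integral_comp_mul_left (fun x => h (y + x)), integral_add_left_eq_self h,
    abs_of_pos (inv_pos.2 hε), ← integral_smul]
  simp only [hh, smul_smul]

/-- The rescaled derivative of the smooth step is an approximate identity of mass T(1) - T(0) = 1,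
concentrated to the right of `y`. After rescaling, the integral is continuous in ε up to ε = 0. -/
theorem tendsto_integral_deriv_smoothTransition_smul [CompleteSpace E] {u : ℝ → E}
    (hu : Continuous u) (y : ℝ) :
    Tendsto (fun n : ℕ => ∫ x, (((1 : ℝ) / (n + 1))⁻¹ *
      deriv Real.smoothTransition (((1 : ℝ) / (n + 1))⁻¹ * (x - y))) • u x) atTop (𝓝 (u y)) := by
  have e : ∀ n : ℕ, (0 : ℝ) < 1 / (n + 1) := fun n => Nat.one_div_pos_of_nat
  simp_rw [fun n : ℕ => integral_deriv_smoothTransition_smul (u := u) y (e n)]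
  have hc : Continuous fun ε : ℝ =>
      ∫ s in (0 : ℝ)..1, deriv Real.smoothTransition s • u (y + ε * s) := by
    refine intervalIntegral.continuous_parametric_intervalIntegral_of_continuous' ?_ 0 1
    have := continuous_deriv_smoothTransition
    fun_prop
  have h0 : ∫ s in (0 : ℝ)..1, deriv Real.smoothTransition s • u (y + 0 * s) = u y := by
    simp only [zero_mul, add_zero]
    rw [intervalIntegral.integral_smul_const, intervalIntegral.integral_deriv_eq_sub]
    · simp
    · intro x _
      exact (Real.smoothTransition.contDiff (n := 1)).differentiable one_ne_zero x
    · exact continuous_deriv_smoothTransition.intervalIntegrable _ _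
  have := (hc.tendsto 0).comp tendsto_one_div_add_atTop_nhds_zero_nat
  rw [h0] at this
  exact this

/-- The weak identity is tested with a difference of two steepening smooth steps, which tends to the
indicator of (y, z] while its derivative tends to δ_y - δ_z. -/
theorem HasWeakDeriv.sub_eq_integral_of_pos [CompleteSpace E] {u v : ℝ → E}
    (h : HasWeakDeriv u v) (hu : ContinuousOn u (Ici 0)) (hv : MemLp v 2 halfLine) {y z : ℝ}
    (hy : 0 < y) (hyz : y ≤ z) : u z - u y = ∫ x in Ioc y z, v x := by
  have hz : 0 < z := hy.trans_le hyz
  -- Constant extension to the left, because the approximate identity is stated for functions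
  -- continuous on the whole line.
  set U : ℝ → E := fun x => u (max x 0) with hU
  have hUc : Continuous U := by
    rw [← continuousOn_univ]
    exact hu.comp (by fun_prop) (fun x _ => mem_Ici.2 (le_max_right _ _))
  have hUu : ∀ x, 0 ≤ x → U x = u x := fun x hx => by simp [hU, max_eq_left hx]
  set T := Real.smoothTransition with hT
  set e : ℕ → ℝ := fun n => ((1 : ℝ) / (n + 1))⁻¹ with he
  have he1 : ∀ n, 1 ≤ e n := fun n => by simp [he]
  have hTd : Differentiable ℝ T :=
    (Real.smoothTransition.contDiff (n := 1)).differentiable one_ne_zero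
  set χ : ℕ → ℝ → ℝ := fun n x => T (e n * (x - y)) - T (e n * (x - z)) with hχ
  have hχd : ∀ n, ContDiff ℝ ∞ (χ n) := by
    intro n
    have := Real.smoothTransition.contDiff (n := ⊤)
    fun_prop
  have hχ' : ∀ n x, deriv (χ n) x =
      e n * deriv T (e n * (x - y)) - e n * deriv T (e n * (x - z)) := by
    intro n x
    have H : ∀ a, HasDerivAt (fun x => T (e n * (x - a))) (e n * deriv T (e n * (x - a))) x := by
      intro a
      have h1 : HasDerivAt (fun x => e n * (x - a)) (e n) x := by
        simpa using ((hasDerivAt_id x).sub_const a).const_mul (e n)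
      have := (hTd (e n * (x - a))).hasDerivAt.comp x h1
      rwa [mul_comm] at this
    exact ((H y).sub (H z)).deriv
  -- Each step has width at most 1 as `e n ≥ 1`, so one bounded set carries all the test functions;
  -- this supplies the dominating function.
  have hsupp : ∀ n x, x ∉ Ioc y (z + 1) → χ n x = 0 := by
    intro n x hx
    rcases le_or_gt x y with h1 | h1
    · have a1 : e n * (x - y) ≤ 0 := mul_nonpos_of_nonneg_of_nonpos (by linarith [he1 n])
        (by linarith)
      have a2 : e n * (x - z) ≤ 0 := mul_nonpos_of_nonneg_of_nonpos (by linarith [he1 n])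
        (by linarith)
      simp [hχ, hT, Real.smoothTransition.zero_of_nonpos a1,
        Real.smoothTransition.zero_of_nonpos a2]
    · have h2 : z + 1 < x := by
        by_contra h2
        exact hx ⟨h1, not_lt.1 h2⟩
      have a1 : 1 ≤ e n * (x - y) := by nlinarith [he1 n]
      have a2 : 1 ≤ e n * (x - z) := by nlinarith [he1 n]
      simp [hχ, hT, Real.smoothTransition.one_of_one_le a1,
        Real.smoothTransition.one_of_one_le a2]
  have htsupp : ∀ n, tsupport (χ n) ⊆ Icc y (z + 1) := by
    intro n
    refine closure_minimal (fun x hx => ?_) isClosed_Icc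
    by_contra hx'
    exact hx (hsupp n x fun h => hx' (Ioc_subset_Icc_self h))
  have hId := fun n => h.integral_eq (χ n) (hχd n)
    (isCompact_Icc.of_isClosed_subset (isClosed_tsupport _) (htsupp n))
    ((htsupp n).trans fun x hx => hy.trans_le hx.1)
  have hL : ∀ n, ∫ x, deriv (χ n) x • u x ∂halfLine =
      (∫ x, (e n * deriv T (e n * (x - y))) • U x) -
      ∫ x, (e n * deriv T (e n * (x - z))) • U x := by
    intro n
    have hcs : ∀ a, Integrable fun x => (e n * deriv T (e n * (x - a))) • U x := by
      intro a
      refine Continuous.integrable_of_hasCompactSupport ?_ ?_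
      · have := continuous_deriv_smoothTransition
        fun_prop
      · refine HasCompactSupport.intro (K := Icc a (a + 1)) isCompact_Icc fun x hx => ?_
        have : deriv T (e n * (x - a)) = 0 := by
          rcases lt_or_ge x a with h1 | h1
          · exact deriv_smoothTransition_of_nonpos
              (mul_nonpos_of_nonneg_of_nonpos (by linarith [he1 n]) (by linarith))
          · have h2 : a + 1 < x := by
              by_contra h2
              exact hx ⟨h1, not_lt.1 h2⟩
            exact deriv_smoothTransition_of_one_le (by nlinarith [he1 n])
        simp [this]
    rw [← integral_sub (hcs y) (hcs z)]
    have h1 : ∫ x, deriv (χ n) x • u x ∂halfLine = ∫ x, deriv (χ n) x • U x ∂halfLine :=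
      setIntegral_congr_fun measurableSet_Ioi fun x hx => by
        simp only [hUu x (le_of_lt hx)]
    rw [h1]
    have h2 : ∫ x, deriv (χ n) x • U x ∂halfLine = ∫ x, deriv (χ n) x • U x := by
      refine setIntegral_eq_integral_of_forall_compl_eq_zero fun x hx => ?_
      have a0 : x ≤ 0 := not_lt.1 hx
      have a1 : e n * (x - y) ≤ 0 := mul_nonpos_of_nonneg_of_nonpos (by linarith [he1 n])
        (by linarith)
      have a2 : e n * (x - z) ≤ 0 := mul_nonpos_of_nonneg_of_nonpos (by linarith [he1 n])
        (by linarith)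
      simp [hχ', hT, deriv_smoothTransition_of_nonpos a1, deriv_smoothTransition_of_nonpos a2]
    rw [h2]
    simp_rw [hχ', sub_smul]
  have hLlim : Tendsto (fun n => ∫ x, deriv (χ n) x • u x ∂halfLine) atTop (𝓝 (u y - u z)) := by
    simp_rw [hL]
    rw [← hUu y hy.le, ← hUu z hz.le]
    exact (tendsto_integral_deriv_smoothTransition_smul hUc y).sub
      (tendsto_integral_deriv_smoothTransition_smul hUc z)
  have hRlim : Tendsto (fun n => ∫ x, χ n x • v x ∂halfLine) atTop
      (𝓝 (∫ x, (Ioc y z).indicator v x ∂halfLine)) := by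
    refine tendsto_integral_of_dominated_convergence
      (fun x => (Ioc 0 (z + 1)).indicator (fun x => ‖v x‖) x) ?_ ?_ ?_ ?_
    · exact fun n => (hχd n).continuous.aestronglyMeasurable.smul hv.1
    · rw [integrable_indicator_iff measurableSet_Ioc]
      exact ((integrableOn_Ioc_of_memLp hv (z + 1)).norm).mono_measure
        (Measure.restrict_mono_measure Measure.restrict_le_self _)
    · intro n
      refine Eventually.of_forall fun x => ?_
      by_cases hx : x ∈ Ioc y (z + 1)
      · rw [indicator_of_mem (show x ∈ Ioc 0 (z + 1) from ⟨hy.trans hx.1, hx.2⟩), norm_smul]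
        refine mul_le_of_le_one_left (norm_nonneg _) ?_
        rw [Real.norm_eq_abs, abs_le]
        have a1 := Real.smoothTransition.nonneg (e n * (x - y))
        have a2 := Real.smoothTransition.nonneg (e n * (x - z))
        have a3 := Real.smoothTransition.le_one (e n * (x - y))
        have a4 := Real.smoothTransition.le_one (e n * (x - z))
        constructor <;> simp only [hχ, hT] <;> linarith
      · rw [hsupp n x hx]
        simpa using indicator_nonneg (fun _ _ => norm_nonneg _) x
    · refine Eventually.of_forall fun x => ?_
      have hlarge : ∀ a, a < x → ∀ᶠ n in atTop, T (e n * (x - a)) = 1 := by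
        intro a ha
        obtain ⟨k, hk⟩ := exists_nat_gt (1 / (x - a))
        filter_upwards [eventually_ge_atTop k] with n hn
        refine Real.smoothTransition.one_of_one_le ?_
        have hxa : 0 < x - a := sub_pos.2 ha
        rw [div_lt_iff₀ hxa] at hk
        have : (k : ℝ) ≤ n := Nat.cast_le.2 hn
        simp only [he, one_div, inv_inv]
        nlinarith
      have hsmall : ∀ a, x ≤ a → ∀ n, T (e n * (x - a)) = 0 := fun a ha n =>
        Real.smoothTransition.zero_of_nonpos
          (mul_nonpos_of_nonneg_of_nonpos (by linarith [he1 n]) (by linarith))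
      -- The smooth step is 0 at its left end, so the limit is the indicator of the half-open
      -- interval at every point, endpoints included.
      rcases le_or_gt x y with h1 | h1
      · rw [indicator_of_notMem (fun h : x ∈ Ioc y z => absurd h.1 (not_lt.2 h1))]
        simp [hχ, hsmall y h1, hsmall z (h1.trans hyz)]
      · rcases le_or_gt x z with h2 | h2
        · rw [indicator_of_mem (show x ∈ Ioc y z from ⟨h1, h2⟩)]
          refine tendsto_const_nhds.congr' ?_
          filter_upwards [hlarge y h1] with n hn
          simp [hχ, hn, hsmall z h2]
        · rw [indicator_of_notMem (fun h : x ∈ Ioc y z => absurd h.2 (not_le.2 h2))]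
          refine tendsto_const_nhds.congr' ?_
          filter_upwards [hlarge y h1, hlarge z h2] with n hn hn'
          simp [hχ, hn, hn']
  have hfin : ∫ x, (Ioc y z).indicator v x ∂halfLine = ∫ x in Ioc y z, v x := by
    rw [integral_indicator measurableSet_Ioc, halfLine, Measure.restrict_restrict measurableSet_Ioc,
      inter_eq_left.2 (Ioc_subset_Ioi_self.trans (Ioi_subset_Ioi hy.le))]
  rw [hfin] at hRlim
  have := tendsto_nhds_unique hLlim ((hRlim.neg).congr fun n => (hId n).symm)
  rw [← neg_sub, this, neg_neg]

/-- Continuity at the left endpoint extends the estimate to y = 0, the vertex. -/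
theorem HasWeakDeriv.norm_sub_le [CompleteSpace E] {u v : ℝ → E}
    (h : HasWeakDeriv u v) (hu : ContinuousOn u (Ici 0)) (hv : MemLp v 2 halfLine) {y z : ℝ}
    (hy : 0 ≤ y) (hyz : y ≤ z) : ‖u z - u y‖ ≤ ∫ x in Ioc y z, ‖v x‖ := by
  rcases hyz.eq_or_lt with rfl | hyz
  · simp
  have hI : IntegrableOn (fun x => ‖v x‖) (Ioc y z) :=
    ((integrableOn_Ioc_of_memLp hv z).mono_set (Ioc_subset_Ioc_left hy)).norm
  have hlim : Tendsto (fun t => ‖u z - u t‖) (𝓝[>] y) (𝓝 ‖u z - u y‖) :=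
    (tendsto_const_nhds.sub ((hu y hy).mono_left
      (nhdsWithin_mono y fun x hx => hy.trans (le_of_lt hx)))).norm
  refine le_of_tendsto hlim ?_
  filter_upwards [Ioo_mem_nhdsGT hyz] with t ht
  rw [h.sub_eq_integral_of_pos hu hv (hy.trans_lt ht.1) ht.2.le]
  exact (norm_integral_le_integral_norm _).trans (setIntegral_mono_set hI
    (Eventually.of_forall fun _ => norm_nonneg _) (Ioc_subset_Ioc_left ht.1.le).eventuallyLE)

end WeakDerivative

/-! ### Absolute continuity and energy bound from the integrated inequality. -/

section AbsolutelyContinuous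

/-- Integration by parts for absolutely continuous functions on [0, R], with R beyond the support of
the test function so that both boundary terms vanish. -/
theorem HasWeakDeriv.of_absolutelyContinuous {f : ℝ → ℝ}
    (hf : ∀ R, 0 ≤ R → AbsolutelyContinuousOnInterval f 0 R) : HasWeakDeriv f (deriv f) := by
  have hc : ContinuousOn f (Ioi 0) := by
    intro x hx
    have h1 := (hf (x + 1) (by linarith [mem_Ioi.1 hx])).continuousOn
    rw [uIcc_of_le (by linarith [mem_Ioi.1 hx])] at h1
    exact (h1.continuousAt (Icc_mem_nhds hx (by linarith))).continuousWithinAt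
  refine ⟨hc.locallyIntegrableOn measurableSet_Ioi, fun x hx => ?_, fun χ h1 h2 h3 => ?_⟩
  · have hx0 : 0 < x := hx
    have h1 := (hf (x + 1) (by linarith)).intervalIntegrable_deriv
    rw [intervalIntegrable_iff_integrableOn_Ioc_of_le (by linarith)] at h1
    exact ⟨Ioc 0 (x + 1), mem_nhdsWithin_of_mem_nhds (Ioc_mem_nhds hx0 (by linarith)), h1⟩
  · obtain ⟨R, hR0, hR⟩ : ∃ R : ℝ, 0 ≤ R ∧ tsupport χ ⊆ Iio R := by
      obtain ⟨R, hR⟩ := h2.isCompact.bddAbove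
      exact ⟨max R 0 + 1, by positivity, fun x hx =>
        ((hR hx).trans (le_max_left R 0)).trans_lt (lt_add_one _)⟩
    have hz : ∀ x, x ∉ tsupport χ → χ x = 0 ∧ deriv χ x = 0 := by
      intro x hx
      refine ⟨image_eq_zero_of_notMem_tsupport hx, ?_⟩
      by_contra hne
      exact hx (support_deriv_subset hne)
    have hI : ∀ k : ℝ → ℝ, (∀ x, x ∉ tsupport χ → k x = 0) →
        ∫ x, k x ∂halfLine = ∫ x in (0 : ℝ)..R, k x := by
      intro k hk
      rw [intervalIntegral.integral_of_le hR0]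
      refine setIntegral_eq_of_subset_of_forall_sdiff_eq_zero measurableSet_Ioi
        Ioc_subset_Ioi_self fun x hx => hk x fun hx' => hx.2 ⟨hx.1, (hR hx').le⟩
    simp only [smul_eq_mul]
    rw [hI _ fun x hx => by simp [(hz x hx).2], hI _ fun x hx => by simp [(hz x hx).1]]
    have hχ : AbsolutelyContinuousOnInterval χ 0 R :=
      ((h1.of_le (by norm_cast)).contDiffOn (s := uIcc 0 R)
        (n := 1)).absolutelyContinuousOnInterval
    rw [hχ.integral_mul_deriv_eq_deriv_mul (hf R hR0)]
    rw [(hz R fun h => lt_irrefl R (hR h)).1, (hz 0 fun h => lt_irrefl (0 : ℝ) (h3 h)).1]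
    simp

/-- A monotone map sends disjoint half-open intervals to intervals that are still disjoint, and
these all lie in (0, T]. -/
theorem sum_abs_sub_le_of_monotone {G : ℝ → ℝ} (hG : Monotone G) {T : ℝ}
    (h0 : ∀ t, 0 ≤ G t) (hT : ∀ t, G t ≤ T) {n : ℕ} {I : ℕ → ℝ × ℝ}
    (hI : Set.PairwiseDisjoint (Finset.range n : Set ℕ) (fun i => uIoc (I i).1 (I i).2)) :
    ∑ i ∈ Finset.range n, |G (I i).2 - G (I i).1| ≤ T := by
  have hT0 : 0 ≤ T := (h0 0).trans (hT 0)
  have hd : Set.PairwiseDisjoint (Finset.range n : Set ℕ)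
      (fun i => uIoc (G (I i).1) (G (I i).2)) := by
    intro i hi j hj hij
    have := hI hi hj hij
    simp only [Function.onFun, uIoc, Ioc_disjoint_Ioc] at this ⊢
    simp only [← hG.map_min, ← hG.map_max]
    exact hG this
  have hv : volume (⋃ i ∈ Finset.range n, uIoc (G (I i).1) (G (I i).2)) =
      ∑ i ∈ Finset.range n, ENNReal.ofReal |G (I i).2 - G (I i).1| := by
    rw [measure_biUnion_finset hd fun i _ => measurableSet_uIoc]
    exact Finset.sum_congr rfl fun i _ => Real.volume_uIoc
  have hle : volume (⋃ i ∈ Finset.range n, uIoc (G (I i).1) (G (I i).2)) ≤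
      volume (Ioc 0 T) := by
    refine measure_mono (iUnion₂_subset fun i _ => ?_)
    exact Ioc_subset_Ioc (le_min (h0 _) (h0 _)) (max_le (hT _) (hT _))
  rw [hv, Real.volume_Ioc, sub_zero, ← ENNReal.ofReal_sum_of_nonneg fun i _ => abs_nonneg _] at hle
  exact (ENNReal.ofReal_le_ofReal_iff hT0).1 hle

variable {g G : ℝ → ℝ} {K T : ℝ}

/-- The hypothesis `(g s - g t)² ≤ K (t - s) (G t - G s)` is an integrated form of `|g'|² ≤ K G'`. -/
theorem absolutelyContinuousOnInterval_of_sq_sub_le (hK : 0 ≤ K) (hG : Monotone G)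
    (h0 : ∀ t, 0 ≤ G t) (hT : ∀ t, G t ≤ T)
    (h : ∀ s t, 0 ≤ s → s ≤ t → (g s - g t) ^ 2 ≤ K * (t - s) * (G t - G s))
    {R : ℝ} (hR : 0 ≤ R) : AbsolutelyContinuousOnInterval g 0 R := by
  have hT0 : 0 ≤ T := (h0 0).trans (hT 0)
  have h' : ∀ s t, 0 ≤ s → 0 ≤ t → |g s - g t| ^ 2 ≤ K * |s - t| * |G t - G s| := by
    intro s t hs ht
    rw [sq_abs]
    rcases le_total s t with hst | hst
    · rw [abs_sub_comm s t, abs_of_nonneg (sub_nonneg.2 hst), abs_of_nonneg (sub_nonneg.2 (hG hst))]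
      exact h s t hs hst
    · rw [abs_of_nonneg (sub_nonneg.2 hst), abs_sub_comm, abs_of_nonneg (sub_nonneg.2 (hG hst)),
        ← neg_sq, neg_sub]
      exact h t s ht hst
  rw [absolutelyContinuousOnInterval_iff]
  intro ε hε
  -- Weight for √(ab) ≤ (a + b)/2 with a = (K/θ)|s - t| and b = θ|G(t) - G(s)|. The b's sum to at
  -- most θT < ε whatever the intervals; then δ = εθ/(K + 1) makes the a's sum to less than ε.
  set θ := ε / (T + 1) with hθ
  have hθ0 : 0 < θ := by positivity
  refine ⟨ε * θ / (K + 1), by positivity, fun E hE hlen => ?_⟩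
  obtain ⟨hE1, hE2⟩ := hE
  rw [uIcc_of_le hR] at hE1
  have hterm : ∀ i ∈ Finset.range E.1, dist (g (E.2 i).1) (g (E.2 i).2) ≤
      (K / θ * dist (E.2 i).1 (E.2 i).2 + θ * |G (E.2 i).2 - G (E.2 i).1|) / 2 := by
    intro i hi
    have a := h' _ _ (hE1 i hi).1.1 (hE1 i hi).2.1
    rw [Real.dist_eq, Real.dist_eq]
    set X := |g (E.2 i).1 - g (E.2 i).2|
    set D := |(E.2 i).1 - (E.2 i).2|
    set Γ := |G (E.2 i).2 - G (E.2 i).1|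
    have hD : 0 ≤ D := abs_nonneg _
    have hΓ : 0 ≤ Γ := abs_nonneg _
    refine abs_le_of_sq_le_sq' ?_ (by positivity) |>.2
    have e : K * D * Γ = (K / θ * D) * (θ * Γ) := by field_simp
    nlinarith [sq_nonneg (K / θ * D - θ * Γ)]
  have hs := sum_abs_sub_le_of_monotone hG h0 hT hE2
  calc _ ≤ ∑ i ∈ Finset.range E.1, (K / θ * dist (E.2 i).1 (E.2 i).2 +
        θ * |G (E.2 i).2 - G (E.2 i).1|) / 2 := Finset.sum_le_sum hterm
    _ = (K / θ * ∑ i ∈ Finset.range E.1, dist (E.2 i).1 (E.2 i).2 +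
        θ * ∑ i ∈ Finset.range E.1, |G (E.2 i).2 - G (E.2 i).1|) / 2 := by
      rw [← Finset.sum_div, Finset.sum_add_distrib, Finset.mul_sum, Finset.mul_sum]
    _ ≤ (K / θ * (ε * θ / (K + 1)) + θ * T) / 2 := by gcongr
    _ < ε := by
      have a1 : K / θ * (ε * θ / (K + 1)) = ε * (K / (K + 1)) := by field_simp
      have a2 : K / (K + 1) < 1 := by rw [div_lt_one (by positivity)]; linarith
      have a3 : θ * T = ε * (T / (T + 1)) := by rw [hθ]; field_simp
      have a4 : T / (T + 1) < 1 := by rw [div_lt_one (by positivity)]; linarith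
      rw [a1, a3]
      nlinarith

theorem sq_deriv_le_of_sq_sub_le
    (h : ∀ s t, 0 ≤ s → s ≤ t → (g s - g t) ^ 2 ≤ K * (t - s) * (G t - G s))
    {x : ℝ} (hx : 0 ≤ x) (hg : DifferentiableAt ℝ g x) (hG : DifferentiableAt ℝ G x) :
    (deriv g x) ^ 2 ≤ K * deriv G x := by
  have h1 := (hg.hasDerivAt.tendsto_slope_zero_right).pow 2
  have h2 := (hG.hasDerivAt.tendsto_slope_zero_right).const_mul K
  refine le_of_tendsto_of_tendsto h1 h2 ?_
  filter_upwards [self_mem_nhdsWithin] with t ht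
  have ht0 : 0 < t := ht
  have := h x (x + t) hx (by linarith)
  rw [smul_eq_mul, smul_eq_mul]
  calc (t⁻¹ * (g (x + t) - g x)) ^ 2 = t⁻¹ ^ 2 * (g x - g (x + t)) ^ 2 := by ring
    _ ≤ t⁻¹ ^ 2 * (K * (x + t - x) * (G (x + t) - G x)) := by gcongr
    _ = K * (t⁻¹ * (G (x + t) - G x)) := by field_simp; ring

/-- By Lebesgue's theorem both monotone functions are differentiable almost everywhere, where g'² ≤
K G'. `G` may jump, but only the inequality ∫ G' ≤ G(n) - G(0) is needed. -/
theorem lintegral_enorm_deriv_sq_le (hK : 0 ≤ K) (hg : Antitone g) (hG : Monotone G)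
    (h0 : ∀ t, 0 ≤ G t) (hT : ∀ t, G t ≤ T)
    (h : ∀ s t, 0 ≤ s → s ≤ t → (g s - g t) ^ 2 ≤ K * (t - s) * (G t - G s)) :
    ∫⁻ x, ‖deriv g x‖ₑ ^ 2 ∂halfLine ≤ ENNReal.ofReal (K * T) := by
  have hdiff : ∀ᵐ x, DifferentiableAt ℝ g x := by
    filter_upwards [hg.neg.ae_differentiableAt] with x hx
    simpa using hx.neg
  have hGn : ∀ x, 0 ≤ deriv G x := fun x => hG.deriv_nonneg
  have hbound : ∀ n : ℕ, ∫⁻ x in Ioc 0 (n : ℝ), ‖deriv g x‖ₑ ^ 2 ≤ ENNReal.ofReal (K * T) := by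
    intro n
    have hi : IntegrableOn (deriv G) (Ioc 0 (n : ℝ)) := by
      have := (hG.monotoneOn (uIcc 0 (n : ℝ))).intervalIntegrable_deriv
      rwa [intervalIntegrable_iff_integrableOn_Ioc_of_le n.cast_nonneg] at this
    have hle : ∫ x in Ioc 0 (n : ℝ), deriv G x ≤ T := by
      have := (hG.monotoneOn (uIcc 0 (n : ℝ))).intervalIntegral_deriv_mem_uIcc
      rw [uIcc_of_le (sub_nonneg.2 (hG n.cast_nonneg)),
        intervalIntegral.integral_of_le n.cast_nonneg] at this
      linarith [this.2, h0 0, hT n]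
    calc ∫⁻ x in Ioc 0 (n : ℝ), ‖deriv g x‖ₑ ^ 2
        ≤ ∫⁻ x in Ioc 0 (n : ℝ), ENNReal.ofReal (K * deriv G x) := by
          refine lintegral_mono_ae ?_
          refine (ae_restrict_iff' measurableSet_Ioc).2 ?_
          filter_upwards [hdiff, hG.ae_differentiableAt] with x h1 h2 hx
          rw [Real.enorm_eq_ofReal_abs, ← ENNReal.ofReal_pow (abs_nonneg _), sq_abs]
          exact ENNReal.ofReal_le_ofReal (sq_deriv_le_of_sq_sub_le h hx.1.le h1 h2)
      _ = ENNReal.ofReal (∫ x in Ioc 0 (n : ℝ), K * deriv G x) :=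
          (ofReal_integral_eq_lintegral_ofReal (hi.const_mul K)
            (Eventually.of_forall fun x => mul_nonneg hK (hGn x))).symm
      _ ≤ ENNReal.ofReal (K * T) := by
          rw [integral_const_mul]
          gcongr
  have hU : (⋃ n : ℕ, Ioc 0 (n : ℝ)) = Ioi 0 := by
    ext x
    simp only [mem_iUnion, mem_Ioc, mem_Ioi]
    exact ⟨fun ⟨_, h⟩ => h.1, fun h => ⟨⌈x⌉₊, h, Nat.le_ceil x⟩⟩
  rw [halfLine, ← hU, setLIntegral_iUnion_of_directed]
  · exact iSup_le hbound
  · exact (monotone_nat_of_le_succ fun n => Ioc_subset_Ioc_right (by simp)).directed_le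

end AbsolutelyContinuous

/-! ### The profile, equimeasurability and the L^p norms. -/

section Profile

variable {E : Type*} [NormedAddCommGroup E] {N : ℕ} {Φ : Fin N → ℝ → E}

theorem levelMeasure_antitone (Φ : Fin N → ℝ → E) : Antitone (levelMeasure Φ) :=
  fun _ _ h => Finset.sum_le_sum fun _ _ => measure_mono fun _ hx => h.trans hx

/-- Keeps the set of levels defining the profile nonempty, with 0 as a member. -/
theorem levelMeasure_of_nonpos (hN : 1 ≤ N) (Φ : Fin N → ℝ → E) {s : ℝ} (hs : s ≤ 0) :
    levelMeasure Φ s = ⊤ := by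
  have h : ∀ j, halfLine {x | s ≤ ‖Φ j x‖} = ⊤ := by
    intro j
    have : {x | s ≤ ‖Φ j x‖} = univ := eq_univ_of_forall fun x => hs.trans (norm_nonneg _)
    rw [this, halfLine, Measure.restrict_apply_univ, Real.volume_Ioi]
  have : Nonempty (Fin N) := ⟨⟨0, hN⟩⟩
  simp [levelMeasure, h, Finset.sum_const, show N ≠ 0 by omega]

/-- The levels `s` with `λ(s) > N t`, of which `profile Φ t` is the supremum. -/
def profileSet (Φ : Fin N → ℝ → E) (t : ℝ) : Set ℝ :=
  {s : ℝ | (N : ℝ≥0∞) * ENNReal.ofReal t < levelMeasure Φ s}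

theorem mem_profileSet {s t : ℝ} :
    s ∈ profileSet Φ t ↔ (N : ℝ≥0∞) * ENNReal.ofReal t < levelMeasure Φ s := Iff.rfl

theorem mem_profileSet_of_nonpos (hN : 1 ≤ N) (Φ : Fin N → ℝ → E) (t : ℝ) {s : ℝ} (hs : s ≤ 0) :
    s ∈ profileSet Φ t := by
  rw [mem_profileSet, levelMeasure_of_nonpos hN Φ hs]
  exact ENNReal.mul_lt_top (ENNReal.natCast_lt_top N) ENNReal.ofReal_lt_top

theorem profileSet_antitone (Φ : Fin N → ℝ → E) : Antitone (profileSet Φ) := by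
  intro s t hst r hr
  refine lt_of_le_of_lt ?_ (mem_profileSet.1 hr)
  gcongr

theorem profile_nonneg (hN : 1 ≤ N) (Φ : Fin N → ℝ → E) (t : ℝ) : 0 ≤ profile Φ t := by
  by_cases h : BddAbove (profileSet Φ t)
  · exact le_csSup h (mem_profileSet_of_nonpos hN Φ t le_rfl)
  -- An unbounded set of reals has `sSup` equal to 0; this can occur at t = 0 when Φ is unbounded.
  · exact (Real.sSup_of_not_bddAbove h).ge

theorem profile_le_profile (hN : 1 ≤ N) {s t : ℝ} (hs : BddAbove (profileSet Φ s)) (hst : s ≤ t) :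
    profile Φ t ≤ profile Φ s :=
  csSup_le_csSup hs ⟨0, mem_profileSet_of_nonpos hN Φ t le_rfl⟩ (profileSet_antitone Φ hst)

theorem lt_levelMeasure_of_lt_profile (hN : 1 ≤ N) {s t : ℝ} (h : s < profile Φ t) :
    (N : ℝ≥0∞) * ENNReal.ofReal t < levelMeasure Φ s := by
  obtain ⟨r, hr, hsr⟩ := exists_lt_of_lt_csSup
    ⟨0, mem_profileSet_of_nonpos hN Φ t le_rfl⟩ h
  exact lt_of_lt_of_le hr (levelMeasure_antitone Φ hsr.le)

theorem levelMeasure_le_of_profile_lt {s t : ℝ} (ht : BddAbove (profileSet Φ t))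
    (h : profile Φ t < s) : levelMeasure Φ s ≤ (N : ℝ≥0∞) * ENNReal.ofReal t := by
  by_contra hlt
  exact absurd (le_csSup ht (not_le.1 hlt : s ∈ profileSet Φ t)) (not_le.2 h)

/-- Passing from ≥ to > gives an exact equivalence: {|Φ| > s} is the increasing union of the sets
{|Φ| ≥ s + 1/(n+1)}, so its measure exceeds Nt as soon as one of theirs does. -/
theorem lt_profile_iff (hN : 1 ≤ N) {s t : ℝ} (ht : BddAbove (profileSet Φ t)) :
    s < profile Φ t ↔
      (N : ℝ≥0∞) * ENNReal.ofReal t < ∑ j, halfLine {x | s < ‖Φ j x‖} := by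
  constructor
  · intro h
    obtain ⟨r, hr, hsr⟩ := exists_lt_of_lt_csSup
      ⟨0, mem_profileSet_of_nonpos hN Φ t le_rfl⟩ h
    refine lt_of_lt_of_le hr (Finset.sum_le_sum fun j _ => measure_mono fun x hx => ?_)
    exact hsr.trans_le hx
  · intro h
    have hlim : Tendsto (fun n : ℕ => levelMeasure Φ (s + 1 / ((n : ℝ) + 1))) atTop
        (𝓝 (∑ j, halfLine {x | s < ‖Φ j x‖})) := by
      refine tendsto_finsetSum _ fun j _ => ?_
      have hU : {x | s < ‖Φ j x‖} = ⋃ n : ℕ, {x | s + 1 / ((n : ℝ) + 1) ≤ ‖Φ j x‖} := by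
        ext x
        simp only [mem_ofPred_eq, mem_iUnion]
        constructor
        · intro hx
          obtain ⟨n, hn⟩ := exists_nat_one_div_lt (sub_pos.2 hx)
          exact ⟨n, by linarith⟩
        · rintro ⟨n, hn⟩
          have : (0 : ℝ) < 1 / (n + 1) := Nat.one_div_pos_of_nat
          linarith
      rw [hU]
      refine tendsto_measure_iUnion_atTop fun m n hmn x hx => ?_
      have := Nat.one_div_le_one_div (α := ℝ) hmn
      simp only [mem_ofPred_eq] at hx ⊢
      linarith
    obtain ⟨n, hn⟩ := (hlim.eventually (lt_mem_nhds h)).exists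
    have : s + 1 / ((n : ℝ) + 1) ≤ profile Φ t := le_csSup ht hn
    have : (0 : ℝ) < 1 / (n + 1) := Nat.one_div_pos_of_nat
    linarith

/-- Chebyshev's inequality for finite p; for p = ∞ the level measure is eventually 0. -/
theorem exists_levelMeasure_le {p : ℝ≥0∞} (hp : 1 ≤ p) (hΦ : MemLpGraph Φ p) {c : ℝ≥0∞}
    (hc : 0 < c) : ∃ s, levelMeasure Φ s ≤ c := by
  suffices h : Tendsto (fun n : ℕ => levelMeasure Φ (n : ℝ)) atTop (𝓝 0) by
    obtain ⟨n, hn⟩ := (h.eventually (gt_mem_nhds hc)).exists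
    exact ⟨n, hn.le⟩
  have h0 : (0 : ℝ≥0∞) = ∑ _j : Fin N, 0 := by simp
  rw [h0]
  refine tendsto_finsetSum _ fun j _ => ?_
  by_cases htop : p = ⊤
  · subst htop
    obtain ⟨B, hB⟩ : ∃ B : ℝ, ∀ᵐ x ∂halfLine, ‖Φ j x‖ ≤ B := by
      refine ⟨(eLpNormEssSup (Φ j) halfLine).toReal, ?_⟩
      have hlt : eLpNormEssSup (Φ j) halfLine < ⊤ := by
        rw [← eLpNorm_exponent_top]; exact (hΦ j).2
      filter_upwards [enorm_ae_le_eLpNormEssSup (Φ j) halfLine] with x hx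
      rw [← toReal_enorm]
      exact ENNReal.toReal_mono hlt.ne hx
    obtain ⟨k, hk⟩ := exists_nat_gt B
    refine tendsto_const_nhds.congr' ?_
    filter_upwards [eventually_ge_atTop k] with n hn
    refine (measure_mono_null ?_ hB).symm
    intro x hx hx'
    have : (k : ℝ) ≤ n := Nat.cast_le.2 hn
    have hx1 : (n : ℝ) ≤ ‖Φ j x‖ := hx
    have hx2 : ‖Φ j x‖ ≤ B := hx'
    linarith
  · have hp0 : p ≠ 0 := (zero_lt_one.trans_le hp).ne'
    have hr : 0 < p.toReal := ENNReal.toReal_pos hp0 htop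
    have hb : ∀ᶠ n : ℕ in atTop, halfLine {x | (n : ℝ) ≤ ‖Φ j x‖} ≤
        ((n : ℝ≥0∞))⁻¹ ^ p.toReal * eLpNorm (Φ j) p halfLine ^ p.toReal := by
      filter_upwards [eventually_ge_atTop 1] with n hn
      have := meas_ge_le_mul_pow_eLpNorm_enorm halfLine hp0 htop (hΦ j).1
        (ε := (n : ℝ≥0∞)) (by simp; omega) (fun h => absurd h (ENNReal.natCast_ne_top n))
      refine le_trans (measure_mono fun x hx => ?_) this
      have hx1 : (n : ℝ) ≤ ‖Φ j x‖ := hx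
      change (n : ℝ≥0∞) ≤ ‖Φ j x‖ₑ
      rw [← ofReal_norm, ← ENNReal.ofReal_natCast]
      exact ENNReal.ofReal_le_ofReal hx1
    refine tendsto_of_tendsto_of_tendsto_of_le_of_le' tendsto_const_nhds ?_
      (Eventually.of_forall fun _ => zero_le) hb
    have h1 : Tendsto (fun n : ℕ => ((n : ℝ≥0∞))⁻¹ ^ p.toReal) atTop (𝓝 0) := by
      have := (ENNReal.continuous_rpow_const (y := p.toReal)).tendsto 0 |>.comp
        ENNReal.tendsto_inv_nat_nhds_zero
      rwa [ENNReal.zero_rpow_of_pos hr] at this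
    have hfin : eLpNorm (Φ j) p halfLine ^ p.toReal ≠ ⊤ :=
      (ENNReal.rpow_lt_top_of_nonneg hr.le (hΦ j).2.ne).ne
    simpa using ENNReal.Tendsto.mul_const h1 (Or.inr hfin)

theorem bddAbove_profileSet (hN : 1 ≤ N) {p : ℝ≥0∞} (hp : 1 ≤ p) (hΦ : MemLpGraph Φ p) {t : ℝ}
    (ht : 0 < t) : BddAbove (profileSet Φ t) := by
  have hc : 0 < (N : ℝ≥0∞) * ENNReal.ofReal t :=
    ENNReal.mul_pos (by simp; omega) (ENNReal.ofReal_pos.2 ht).ne'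
  obtain ⟨s, hs⟩ := exists_levelMeasure_le hp hΦ hc
  refine ⟨s, fun r hr => ?_⟩
  by_contra h
  exact absurd ((mem_profileSet.1 hr).trans_le (levelMeasure_antitone Φ (not_le.1 h).le)) (not_lt.2 hs)

/-- The point 0 is left out since for unbounded Φ the supremum there takes its default value 0. -/
theorem antitoneOn_profile (hN : 1 ≤ N) (hb : ∀ t, 0 < t → BddAbove (profileSet Φ t)) :
    AntitoneOn (profile Φ) (Ioi 0) :=
  fun _ hs _ _ hst => profile_le_profile hN (hb _ hs) hst

theorem volume_setOf_ofReal_lt (c : ℝ≥0∞) :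
    volume {x : ℝ | 0 < x ∧ ENNReal.ofReal x < c} = c := by
  by_cases hc : c = ⊤
  · subst hc
    have : {x : ℝ | 0 < x ∧ ENNReal.ofReal x < ⊤} = Ioi 0 := by ext; simp
    rw [this, Real.volume_Ioi]
  · have : {x : ℝ | 0 < x ∧ ENNReal.ofReal x < c} = Ioo 0 c.toReal := by
      ext x
      simp only [mem_ofPred_eq, mem_Ioo, and_congr_right_iff]
      exact fun hx => ENNReal.ofReal_lt_iff_lt_toReal hx.le hc
    rw [this, Real.volume_Ioo, sub_zero, ENNReal.ofReal_toReal hc]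

/-- `Φ*` and `Φ` are equimeasurable. -/
theorem measure_lt_profile (hN : 1 ≤ N) (hb : ∀ t, 0 < t → BddAbove (profileSet Φ t)) (s : ℝ) :
    (N : ℝ≥0∞) * halfLine {x | s < profile Φ x} = ∑ j, halfLine {x | s < ‖Φ j x‖} := by
  set c := ∑ j, halfLine {x | s < ‖Φ j x‖}
  have hN0 : (N : ℝ≥0∞) ≠ 0 := by simp; omega
  have hNt : (N : ℝ≥0∞) ≠ ⊤ := ENNReal.natCast_ne_top N
  have hset : {x | s < profile Φ x} ∩ Ioi 0 =
      {x : ℝ | 0 < x ∧ ENNReal.ofReal x < c / N} := by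
    ext x
    simp only [mem_inter_iff, mem_ofPred_eq, mem_Ioi]
    rw [and_comm]
    refine and_congr_right fun hx => ?_
    rw [lt_profile_iff hN (hb x hx), ENNReal.lt_div_iff_mul_lt (Or.inl hN0) (Or.inl hNt), mul_comm]
  rw [halfLine, Measure.restrict_apply' measurableSet_Ioi, hset, volume_setOf_ofReal_lt,
    ENNReal.mul_div_cancel hN0 hNt]

theorem aestronglyMeasurable_profile (hN : 1 ≤ N)
    (hb : ∀ t, 0 < t → BddAbove (profileSet Φ t)) :
    AEStronglyMeasurable (profile Φ) halfLine :=
  (aemeasurable_restrict_of_antitoneOn measurableSet_Ioi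
    (antitoneOn_profile hN hb)).aestronglyMeasurable

theorem eLpNorm_top_le_iff {f : ℝ → E} {s : ℝ} (hs : 0 ≤ s) :
    eLpNorm f ⊤ halfLine ≤ ENNReal.ofReal s ↔ halfLine {x | s < ‖f x‖} = 0 := by
  have hset : ∀ x, ‖f x‖ₑ ≤ ENNReal.ofReal s ↔ ¬ s < ‖f x‖ := by
    intro x
    rw [← ofReal_norm, ENNReal.ofReal_le_ofReal_iff hs, not_lt]
  rw [eLpNorm_exponent_top]
  constructor
  · intro h
    refine measure_mono_null ?_ (enorm_ae_le_eLpNormEssSup f halfLine)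
    exact fun x hx hx' => (hset x).1 (le_trans hx' h) hx
  · intro h
    refine essSup_le_of_ae_le _ ?_
    filter_upwards [measure_eq_zero_iff_ae_notMem.1 h] with x hx
    exact (hset x).2 hx

theorem eLpNorm_rpow_eq_lintegral {f : ℝ → E} (hf : AEStronglyMeasurable f halfLine) {p : ℝ≥0∞}
    (hp : 1 ≤ p) (htop : p ≠ ⊤) : eLpNorm f p halfLine ^ p.toReal =
      ENNReal.ofReal p.toReal *
        ∫⁻ t in Ioi 0, halfLine {x | t < ‖f x‖} * ENNReal.ofReal (t ^ (p.toReal - 1)) := by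
  have hp0 : p ≠ 0 := (zero_lt_one.trans_le hp).ne'
  have hr : 0 < p.toReal := ENNReal.toReal_pos hp0 htop
  rw [eLpNorm_eq_lintegral_rpow_enorm_toReal hp0 htop, ← ENNReal.rpow_mul, one_div_mul_cancel hr.ne',
    ENNReal.rpow_one, ← lintegral_rpow_eq_lintegral_meas_lt_mul halfLine
      (f := fun x => ‖f x‖) (Eventually.of_forall fun _ => norm_nonneg _) hf.norm.aemeasurable hr]
  refine lintegral_congr fun x => ?_
  rw [← ENNReal.ofReal_rpow_of_nonneg (norm_nonneg _) hr.le, ofReal_norm]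

/-- Both norms are functions of the distribution function: by the layer-cake formula for finite p,
and through its zeros for p = ∞. Equimeasurability then suffices. -/
theorem graphNorm_rearrangement (hN : 1 ≤ N) {p : ℝ≥0∞} (hp : 1 ≤ p) (hΦ : MemLpGraph Φ p) :
    graphNorm (rearrangement Φ) p = graphNorm Φ p := by
  have hb : ∀ t, 0 < t → BddAbove (profileSet Φ t) := fun t ht => bddAbove_profileSet hN hp hΦ ht
  have hnorm : ∀ x, ‖profile Φ x‖ = profile Φ x :=
    fun x => Real.norm_of_nonneg (profile_nonneg hN Φ x)
  have hN0 : (N : ℝ≥0∞) ≠ 0 := by simp; omega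
  have : Nonempty (Fin N) := ⟨⟨0, hN⟩⟩
  by_cases htop : p = ⊤
  · subst htop
    have hr : ∀ j, rearrangement Φ j = profile Φ := fun _ => rfl
    simp only [graphNorm, if_true, hr, ciSup_const]
    have key : ∀ s : ℝ, 0 ≤ s → (eLpNorm (profile Φ) ⊤ halfLine ≤ ENNReal.ofReal s ↔
        ⨆ j, eLpNorm (Φ j) ⊤ halfLine ≤ ENNReal.ofReal s) := by
      intro s hs
      rw [eLpNorm_top_le_iff hs, iSup_le_iff]
      simp_rw [eLpNorm_top_le_iff hs, hnorm]
      have := measure_lt_profile hN hb s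
      constructor
      · intro h j
        rw [h, mul_zero] at this
        exact Finset.sum_eq_zero_iff.1 this.symm j (Finset.mem_univ j)
      · intro h
        simp only [h, Finset.sum_const_zero, mul_eq_zero, hN0, false_or] at this
        exact this
    have hle : ∀ a b : ℝ≥0∞, (∀ s : ℝ, 0 ≤ s → b ≤ ENNReal.ofReal s → a ≤ ENNReal.ofReal s) →
        a ≤ b := by
      intro a b h
      by_cases hbt : b = ⊤
      · simp [hbt]
      · have := h b.toReal ENNReal.toReal_nonneg
        rw [ENNReal.ofReal_toReal hbt] at this
        exact this le_rfl
    exact le_antisymm (hle _ _ fun s hs => (key s hs).2) (hle _ _ fun s hs => (key s hs).1)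
  · have hr : p.toReal ≠ 0 :=
      (ENNReal.toReal_pos (zero_lt_one.trans_le hp).ne' htop).ne'
    have hrr : ∀ j, rearrangement Φ j = profile Φ := fun _ => rfl
    simp only [graphNorm, if_neg htop, hrr]
    congr 1
    simp_rw [eLpNorm_rpow_eq_lintegral (aestronglyMeasurable_profile hN hb) hp htop,
      fun j => eLpNorm_rpow_eq_lintegral (hΦ j).1 hp htop]
    have hmeas : ∀ f : ℝ → E, Measurable fun t : ℝ =>
        halfLine {x | t < ‖f x‖} * ENNReal.ofReal (t ^ (p.toReal - 1)) := by
      intro f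
      refine Measurable.mul (Antitone.measurable fun s t hst => ?_) (by fun_prop)
      exact measure_mono fun x hx => hst.trans_lt hx
    rw [← Finset.mul_sum, ← Finset.mul_sum, ← lintegral_finsetSum _ fun j _ => hmeas (Φ j),
      Finset.sum_const, Finset.card_univ, Fintype.card_fin, nsmul_eq_mul,
      ← lintegral_const_mul' _ _ (ENNReal.natCast_ne_top N)]
    congr 1
    refine lintegral_congr fun t => ?_
    simp_rw [hnorm]
    rw [← mul_assoc, measure_lt_profile hN hb t, Finset.sum_mul]

theorem memLpGraph_rearrangement (hN : 1 ≤ N) {p : ℝ≥0∞} (hp : 1 ≤ p) (hΦ : MemLpGraph Φ p) :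
    MemLpGraph (rearrangement Φ) p := by
  have hb : ∀ t, 0 < t → BddAbove (profileSet Φ t) := fun t ht => bddAbove_profileSet hN hp hΦ ht
  refine fun j => ⟨aestronglyMeasurable_profile hN hb, ?_⟩
  have h := graphNorm_rearrangement hN hp hΦ
  by_cases htop : p = ⊤
  · subst htop
    simp only [graphNorm, if_true] at h
    refine (le_iSup (fun j => eLpNorm (rearrangement Φ j) ⊤ halfLine) j).trans_lt ?_
    rw [h]
    have : Nonempty (Fin N) := ⟨j⟩
    obtain ⟨i, hi⟩ := exists_eq_ciSup_of_finite (f := fun j => eLpNorm (Φ j) ⊤ halfLine)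
    rw [← hi]
    exact (hΦ i).2
  · have hr : 0 < p.toReal := ENNReal.toReal_pos (zero_lt_one.trans_le hp).ne' htop
    simp only [graphNorm, if_neg htop] at h
    have h' := ENNReal.rpow_left_injective (one_div_pos.2 hr).ne' h
    have hlt : ∑ j, eLpNorm (Φ j) p halfLine ^ p.toReal < ⊤ :=
      ENNReal.sum_lt_top.2 fun i _ => ENNReal.rpow_lt_top_of_nonneg hr.le (hΦ i).2.ne
    rw [← h'] at hlt
    have := ENNReal.sum_lt_top.1 hlt j (Finset.mem_univ j)
    exact (ENNReal.rpow_lt_top_iff_of_pos hr).1 this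

end Profile

/-! ### Crossings of a level band. -/

section Crossing

/-- Take for `p` the last point where u ≤ c, and for `q` the first point after it where u ≥ d. -/
theorem exists_crossing_up {u : ℝ → ℝ} {y z c d : ℝ} (hyz : y ≤ z) (hu : ContinuousOn u (Icc y z))
    (hy : u y ≤ c) (hz : d ≤ u z) : ∃ p q, y ≤ p ∧ p ≤ q ∧ q ≤ z ∧ u p ≤ c ∧ d ≤ u q ∧
      ∀ t ∈ Ioo p q, c < u t ∧ u t < d := by
  have hS : IsCompact (Icc y z ∩ u ⁻¹' Iic c) :=
    isCompact_Icc.of_isClosed_subset (hu.preimage_isClosed_of_isClosed isClosed_Icc isClosed_Iic)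
      inter_subset_left
  obtain ⟨p, ⟨hp, hpc⟩, hpu⟩ := hS.exists_isGreatest ⟨y, ⟨le_rfl, hyz⟩, hy⟩
  have hu' : ContinuousOn u (Icc p z) := hu.mono (Icc_subset_Icc_left hp.1)
  have hS' : IsCompact (Icc p z ∩ u ⁻¹' Ici d) :=
    isCompact_Icc.of_isClosed_subset (hu'.preimage_isClosed_of_isClosed isClosed_Icc isClosed_Ici)
      inter_subset_left
  obtain ⟨q, ⟨hq, hqd⟩, hql⟩ := hS'.exists_isLeast ⟨z, ⟨hp.2, le_rfl⟩, hz⟩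
  refine ⟨p, q, hp.1, hq.1, hq.2, hpc, hqd, fun t ht => ⟨?_, ?_⟩⟩
  · by_contra h
    exact absurd (hpu ⟨⟨hp.1.trans ht.1.le, ht.2.le.trans hq.2⟩, not_lt.1 h⟩) (not_le.2 ht.1)
  · by_contra h
    exact absurd (hql ⟨⟨ht.1.le, ht.2.le.trans hq.2⟩, not_lt.1 h⟩) (not_le.2 ht.2)

theorem exists_crossing_down {u : ℝ → ℝ} {y z c d : ℝ} (hyz : y ≤ z)
    (hu : ContinuousOn u (Icc y z)) (hy : d ≤ u y) (hz : u z ≤ c) :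
    ∃ p q, y ≤ p ∧ p ≤ q ∧ q ≤ z ∧ d ≤ u p ∧ u q ≤ c ∧ ∀ t ∈ Ioo p q, c < u t ∧ u t < d := by
  obtain ⟨p, q, h1, h2, h3, h4, h5, h6⟩ := exists_crossing_up (u := fun t => -u t)
    (c := -d) (d := -c) hyz hu.neg (neg_le_neg hy) (neg_le_neg hz)
  refine ⟨p, q, h1, h2, h3, neg_le_neg_iff.1 h4, neg_le_neg_iff.1 h5, fun t ht => ?_⟩
  exact ⟨neg_lt_neg_iff.1 (h6 t ht).2, neg_lt_neg_iff.1 (h6 t ht).1⟩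

/-- The open set of points of `(0, ∞)` where `c < ‖u‖ < d`. -/
def levelBand {E : Type*} [NormedAddCommGroup E] (u : ℝ → E) (c d : ℝ) : Set ℝ :=
  Ioi 0 ∩ (fun x => ‖u x‖) ⁻¹' Ioo c d

variable {E : Type*} [NormedAddCommGroup E] [NormedSpace ℝ E]

omit [NormedSpace ℝ E] in
theorem isOpen_levelBand {u : ℝ → E} (hu : ContinuousOn u (Ici 0)) (c d : ℝ) :
    IsOpen (levelBand u c d) :=
  (hu.norm.mono Ioi_subset_Ici_self).isOpen_inter_preimage isOpen_Ioi isOpen_Ioo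

/-- Truncation of a real number to `[c, d]`. -/
def clamp (c d t : ℝ) : ℝ := max c (min d t)

/-- Between two distinct clamped values there is a crossing interval whose interior lies in the
band, and the fundamental theorem is applied there only. No chain rule for |u| or its truncation is
required. -/
theorem abs_clamp_sub_le [CompleteSpace E] {u v : ℝ → E} (h : HasWeakDeriv u v)
    (hu : ContinuousOn u (Ici 0)) (hv : MemLp v 2 halfLine) {y z c d : ℝ} (hy : 0 ≤ y)
    (hyz : y ≤ z) (hcd : c ≤ d) :
    |clamp c d ‖u z‖ - clamp c d ‖u y‖| ≤ ∫ x in Ioc y z ∩ levelBand u c d, ‖v x‖ := by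
  have hI : IntegrableOn (fun x => ‖v x‖) (Ioc y z ∩ levelBand u c d) :=
    ((integrableOn_Ioc_of_memLp hv z).mono_set
      (inter_subset_left.trans (Ioc_subset_Ioc_left hy))).norm
  have hcont : ContinuousOn (fun x => ‖u x‖) (Icc y z) :=
    hu.norm.mono fun x hx => hy.trans hx.1
  have hpq : ∀ p q c' d', y ≤ p → p ≤ q → q ≤ z → c ≤ c' → d' ≤ d →
      (∀ t ∈ Ioo p q, c' < ‖u t‖ ∧ ‖u t‖ < d') →
      |‖u q‖ - ‖u p‖| ≤ ∫ x in Ioc y z ∩ levelBand u c d, ‖v x‖ := by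
    intro p q c' d' h1 h2 h3 h4 h5 h6
    calc |‖u q‖ - ‖u p‖| ≤ ‖u q - u p‖ := abs_norm_sub_norm_le _ _
      _ ≤ ∫ x in Ioc p q, ‖v x‖ := h.norm_sub_le hu hv (hy.trans h1) h2
      _ = ∫ x in Ioo p q, ‖v x‖ := integral_Ioc_eq_integral_Ioo
      _ ≤ _ := by
        refine setIntegral_mono_set hI (Eventually.of_forall fun _ => norm_nonneg _)
          (LE.le.eventuallyLE fun t ht => ?_)
        exact ⟨⟨h1.trans_lt ht.1, ht.2.le.trans h3⟩, hy.trans_lt (h1.trans_lt ht.1),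
          h4.trans_lt (h6 t ht).1, (h6 t ht).2.trans_le h5⟩
  have hc : ∀ t, c ≤ clamp c d t := fun t => le_max_left _ _
  have hd : ∀ t, clamp c d t ≤ d := fun t => max_le hcd (min_le_left _ _)
  -- Truncation from above is inactive here, so clamping can only have raised the value; `hgt` is
  -- the mirror image. Thus the clamped values serve as levels of the crossing.
  have hlt : ∀ t, clamp c d t < d → t ≤ clamp c d t := by
    intro t ht
    simp only [clamp, max_lt_iff, min_lt_iff, lt_irrefl, false_or] at ht ⊢
    rw [min_eq_right ht.2.le]
    exact le_max_right _ _
  have hgt : ∀ t, c < clamp c d t → clamp c d t ≤ t := by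
    intro t ht
    simp only [clamp, lt_max_iff, lt_irrefl, false_or] at ht ⊢
    rw [max_eq_right ht.le]
    exact min_le_right _ _
  rcases lt_trichotomy (clamp c d ‖u y‖) (clamp c d ‖u z‖) with hlt' | heq | hgt'
  · obtain ⟨p, q, h1, h2, h3, h4, h5, h6⟩ := exists_crossing_up hyz hcont
      (hlt _ (hlt'.trans_le (hd _))) (hgt _ ((hc _).trans_lt hlt'))
    refine le_trans ?_ (hpq p q _ _ h1 h2 h3 (hc _) (hd _) h6)
    rw [abs_of_pos (sub_pos.2 hlt')]
    exact le_trans (by linarith) (le_abs_self _)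
  · rw [heq, sub_self, abs_zero]
    exact integral_nonneg fun _ => norm_nonneg _
  · obtain ⟨p, q, h1, h2, h3, h4, h5, h6⟩ := exists_crossing_down hyz hcont
      (hgt _ ((hc _).trans_lt hgt')) (hlt _ (hgt'.trans_le (hd _)))
    refine le_trans ?_ (hpq p q _ _ h1 h2 h3 (hc _) (hd _) h6)
    rw [abs_of_neg (sub_neg.2 hgt')]
    exact le_trans (by linarith) (neg_le_abs _)

end Crossing

/-! ### The integrated inequality for the profile. -/

section Energy

variable {E : Type*} [NormedAddCommGroup E] [NormedSpace ℝ E] [CompleteSpace E] {N : ℕ}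
  {Φ v : Fin N → ℝ → E}

omit [CompleteSpace E] in
theorem MemEnergy.memLpGraph (h : MemEnergy Φ) : MemLpGraph Φ 2 := fun j => (h.memH1 j).1

omit [NormedSpace ℝ E] [CompleteSpace E] in
theorem exists_norm_lt_of_levelMeasure_lt {j : Fin N} {s x ℓ : ℝ} (hx : 0 ≤ x)
    (h : levelMeasure Φ s < ENNReal.ofReal ℓ) : ∃ y ∈ Ioc x (x + ℓ), ‖Φ j y‖ < s := by
  by_contra hcon
  push Not at hcon
  refine absurd h (not_lt.2 ?_)
  have h1 : halfLine {y | s ≤ ‖Φ j y‖} ≤ levelMeasure Φ s :=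
    Finset.single_le_sum (f := fun j => halfLine {y | s ≤ ‖Φ j y‖}) (fun _ _ => zero_le)
      (Finset.mem_univ j)
  refine le_trans ?_ h1
  have h2 : halfLine (Ioc x (x + ℓ)) = ENNReal.ofReal ℓ := by
    rw [halfLine, Measure.restrict_apply measurableSet_Ioc,
      inter_eq_left.2 (Ioc_subset_Ioi_self.trans (Ioi_subset_Ioi hx)), Real.volume_Ioc,
      add_sub_cancel_left]
  rw [← h2]
  exact measure_mono fun y hy => hcon y hy

/-- Some level set has measure below 1, so a point with |Φ| < s lies within distance 1 of any given
point; the change in between is controlled by |v| ≤ 1 + |v|². Boundedness makes the profile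
meaningful at t = 0 too. -/
theorem exists_norm_le (hE : MemEnergy Φ) :
    ∃ B, ∀ j x, 0 ≤ x → ‖Φ j x‖ ≤ B := by
  obtain ⟨s, hs⟩ := exists_levelMeasure_le one_le_two hE.memLpGraph
    (c := ENNReal.ofReal (1 / 2)) (by simp)
  have hs' : levelMeasure Φ s < ENNReal.ofReal 1 :=
    hs.trans_lt ((ENNReal.ofReal_lt_ofReal_iff one_pos).2 (by norm_num))
  choose v hv hv2 using fun j => (hE.memH1 j).2
  have hbound : ∀ j, ∃ B, ∀ x, 0 ≤ x → ‖Φ j x‖ ≤ B := by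
    intro j
    have hsq : Integrable (fun x => ‖v j x‖ ^ 2) halfLine := (hv2 j).integrable_norm_pow two_ne_zero
    refine ⟨s + (1 + ∫ x, ‖v j x‖ ^ 2 ∂halfLine), fun x hx => ?_⟩
    obtain ⟨y, hy, hys⟩ := exists_norm_lt_of_levelMeasure_lt (j := j) hx hs'
    have h1 := (hv j).norm_sub_le (hE.continuousOn j) (hv2 j) hx hy.1.le
    have hsub : Ioc x y ⊆ Ioi 0 := Ioc_subset_Ioi_self.trans (Ioi_subset_Ioi hx)
    have hi2 : IntegrableOn (fun t => ‖v j t‖ ^ 2) (Ioc x y) := IntegrableOn.mono_set hsq hsub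
    have h2 : ∫ t in Ioc x y, ‖v j t‖ ≤ ∫ t in Ioc x y, (1 + ‖v j t‖ ^ 2) := by
      refine integral_mono ?_ ((integrable_const _).add hi2) fun t => ?_
      · exact ((integrableOn_Ioc_of_memLp (hv2 j) y).mono_set (Ioc_subset_Ioc_left hx)).norm
      · change ‖v j t‖ ≤ 1 + ‖v j t‖ ^ 2
        nlinarith [sq_nonneg (‖v j t‖ - 1), sq_nonneg ‖v j t‖]
    rw [integral_add (integrable_const _) hi2] at h2
    have h3 : ∫ t in Ioc x y, ‖v j t‖ ^ 2 ≤ ∫ x, ‖v j x‖ ^ 2 ∂halfLine :=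
      setIntegral_mono_set hsq (Eventually.of_forall fun _ => sq_nonneg _) hsub.eventuallyLE
    have h4 : ∫ _t in Ioc x y, (1 : ℝ) ≤ 1 := by
      rw [setIntegral_const, smul_eq_mul, mul_one, Real.volume_real_Ioc_of_le hy.1.le]
      linarith [hy.2]
    have h5 : ‖Φ j x‖ ≤ ‖Φ j y‖ + ‖Φ j y - Φ j x‖ := by
      have := norm_sub_le (Φ j y) (Φ j y - Φ j x)
      rwa [sub_sub_cancel] at this
    linarith
  choose B hB using hbound
  refine ⟨∑ j, |B j|, fun j x hx => (hB j x hx).trans ((le_abs_self _).trans ?_)⟩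
  exact Finset.single_le_sum (f := fun j => |B j|) (fun _ _ => abs_nonneg _) (Finset.mem_univ j)

omit [NormedSpace ℝ E] [CompleteSpace E] in
theorem bddAbove_profileSet_of_bound {B : ℝ} (hB : ∀ j x, 0 ≤ x → ‖Φ j x‖ ≤ B) (t : ℝ) :
    BddAbove (profileSet Φ t) := by
  refine ⟨B, fun s hs => ?_⟩
  by_contra h
  have h0 : levelMeasure Φ s = 0 := by
    refine Finset.sum_eq_zero fun j _ => ?_
    rw [halfLine, Measure.restrict_apply' measurableSet_Ioi]
    refine measure_mono_null (fun x hx => ?_) measure_empty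
    have h1 : s ≤ ‖Φ j x‖ := hx.1
    exact absurd (h1.trans (hB j x (le_of_lt hx.2))) h
  rw [mem_profileSet, h0] at hs
  exact not_lt_zero hs

/-- On a star graph a level band is crossed at least once, and at least twice if there are two or
more edges. -/
theorem mul_sub_le_sum_integral_levelBand (hE : MemEnergy Φ) (hw : ∀ j, HasWeakDeriv (Φ j) (v j))
    (hv : ∀ j, MemLp (v j) 2 halfLine) {m c d : ℝ} (hm : m = 1 ∨ (m = 2 ∧ 2 ≤ N)) (hcd : c ≤ d)
    (hc : levelMeasure Φ c < ⊤) (hd : 0 < levelMeasure Φ d) :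
    m * (d - c) ≤ ∑ j, ∫ x in levelBand (Φ j) c d, ‖v j x‖ := by
  obtain ⟨j, x, hx, hjx⟩ : ∃ j x, 0 ≤ x ∧ d ≤ ‖Φ j x‖ := by
    by_contra hcon
    push Not at hcon
    have h0 : levelMeasure Φ d = 0 := by
      refine Finset.sum_eq_zero fun j _ => ?_
      rw [halfLine, Measure.restrict_apply' measurableSet_Ioi]
      refine measure_mono_null (fun x hx => ?_) measure_empty
      exact absurd (hcon j x (le_of_lt hx.2)) (not_lt.2 hx.1)
    exact hd.ne' h0
  have hfar : ∀ i, ∀ y, 0 ≤ y → ∃ z, y ≤ z ∧ ‖Φ i z‖ ≤ c := by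
    intro i y hy
    have : levelMeasure Φ c < ENNReal.ofReal ((levelMeasure Φ c).toReal + 1) := by
      rw [ENNReal.lt_ofReal_iff_toReal_lt hc.ne]; linarith
    obtain ⟨z, hz, hz'⟩ := exists_norm_lt_of_levelMeasure_lt (j := i) hy this
    exact ⟨z, hz.1.le, hz'.le⟩
  -- Since λ(c) < ∞ the band has finite length, on which L² is contained in L¹.
  have hI : ∀ i, IntegrableOn (fun x => ‖v i x‖) (levelBand (Φ i) c d) := by
    intro i
    have hfin : IsFiniteMeasure (volume.restrict (levelBand (Φ i) c d)) := by
      refine ⟨?_⟩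
      rw [Measure.restrict_apply_univ]
      refine lt_of_le_of_lt ?_ hc
      refine le_trans ?_ (Finset.single_le_sum (f := fun j => halfLine {y | c ≤ ‖Φ j y‖})
        (fun _ _ => zero_le) (Finset.mem_univ i))
      rw [halfLine, Measure.restrict_apply' measurableSet_Ioi]
      exact measure_mono fun x hx => ⟨le_of_lt hx.2.1, hx.1⟩
    have : MemLp (v i) 2 (volume.restrict (levelBand (Φ i) c d)) :=
      (hv i).mono_measure (Measure.restrict_mono inter_subset_left le_rfl)
    exact (this.integrable one_le_two).norm
  have hmono : ∀ i (S : Set ℝ), S ⊆ levelBand (Φ i) c d →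
      ∫ x in S, ‖v i x‖ ≤ ∫ x in levelBand (Φ i) c d, ‖v i x‖ := fun i S hS =>
    setIntegral_mono_set (hI i) (Eventually.of_forall fun _ => norm_nonneg _) hS.eventuallyLE
  have hclampc : ∀ t, t ≤ c → clamp c d t = c := fun t ht => by
    rw [clamp, max_eq_left ((min_le_right _ _).trans ht)]
  have hclampd : ∀ t, d ≤ t → clamp c d t = d := fun t ht => by
    rw [clamp, min_eq_left ht, max_eq_right hcd]
  have hpos : ∀ i, 0 ≤ ∫ x in levelBand (Φ i) c d, ‖v i x‖ :=
    fun i => integral_nonneg fun _ => norm_nonneg _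
  obtain ⟨z, hxz, hz⟩ := hfar j x hx
  have h1 := abs_clamp_sub_le (hw j) (hE.continuousOn j) (hv j) hx hxz hcd
  rw [hclampc _ hz, hclampd _ hjx, abs_sub_comm, abs_of_nonneg (sub_nonneg.2 hcd)] at h1
  rcases hm with rfl | ⟨rfl, hN⟩
  · rw [one_mul]
    exact (h1.trans (hmono j _ inter_subset_right)).trans (Finset.single_le_sum
      (f := fun j => ∫ x in levelBand (Φ j) c d, ‖v j x‖) (fun i _ => hpos i) (Finset.mem_univ j))
  -- With a the clamped value at the vertex, three paths contribute: d - c from x outwards, d - a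
  -- from x to the vertex, and a - c along another edge. They add up to 2(d - c) wherever a lies in
  -- [c, d].
  · have h2 := abs_clamp_sub_le (hw j) (hE.continuousOn j) (hv j) le_rfl hx hcd
    rw [hclampd _ hjx] at h2
    have h3 : (∫ t in Ioc 0 x ∩ levelBand (Φ j) c d, ‖v j t‖) +
        ∫ t in Ioc x z ∩ levelBand (Φ j) c d, ‖v j t‖ ≤
        ∫ t in levelBand (Φ j) c d, ‖v j t‖ := by
      rw [← setIntegral_union]
      · exact hmono j _ (union_subset inter_subset_right inter_subset_right)
      · exact ((Ioc_disjoint_Ioc_of_le le_rfl).mono inter_subset_left inter_subset_left)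
      · exact measurableSet_Ioc.inter (isOpen_levelBand (hE.continuousOn j) c d).measurableSet
      · exact (hI j).mono_set inter_subset_right
      · exact (hI j).mono_set inter_subset_right
    have : Nontrivial (Fin N) := Fin.nontrivial_iff_two_le.2 hN
    obtain ⟨i, hij⟩ := exists_ne j
    obtain ⟨z', hz'0, hz'⟩ := hfar i 0 le_rfl
    have h4 := (abs_clamp_sub_le (hw i) (hE.continuousOn i) (hv i) le_rfl hz'0 hcd).trans
      (hmono i _ inter_subset_right)
    rw [hclampc _ hz', hE.vertex i j] at h4
    have h5 : (∫ t in levelBand (Φ j) c d, ‖v j t‖) + ∫ t in levelBand (Φ i) c d, ‖v i t‖ ≤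
        ∑ j, ∫ x in levelBand (Φ j) c d, ‖v j x‖ := by
      rw [← Finset.sum_pair (f := fun j => ∫ x in levelBand (Φ j) c d, ‖v j x‖) hij.symm]
      exact Finset.sum_le_sum_of_subset_of_nonneg (Finset.subset_univ _) fun i _ _ => hpos i
    have h6 := le_abs_self (d - clamp c d ‖Φ j 0‖)
    have h7 := neg_le_abs (c - clamp c d ‖Φ j 0‖)
    linarith

omit [CompleteSpace E] in
-- The band is disjoint from {|Φ| ≥ d} inside {|Φ| ≥ c}, while λ(d) > N t₁ and λ(c) ≤ N t₂. Levels
-- strictly between the two profile values keep plateaus of |Φ| harmless.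
theorem sum_volume_levelBand_le (hN : 1 ≤ N) (hE : MemEnergy Φ) {t₁ t₂ c d : ℝ} (h1 : 0 ≤ t₁)
    (hb : BddAbove (profileSet Φ t₂)) (hc : profile Φ t₂ < c) (hd : d < profile Φ t₁)
    (hcd : c ≤ d) (h12 : t₁ ≤ t₂) :
    (∀ j, volume (levelBand (Φ j) c d) < ⊤) ∧
    ∑ j, volume.real (levelBand (Φ j) c d) ≤ N * (t₂ - t₁) := by
  have hsum : ∑ j, volume (levelBand (Φ j) c d) + levelMeasure Φ d ≤ levelMeasure Φ c := by
    rw [levelMeasure, levelMeasure, ← Finset.sum_add_distrib]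
    refine Finset.sum_le_sum fun j _ => ?_
    have hm : MeasurableSet (levelBand (Φ j) c d) :=
      (isOpen_levelBand (hE.continuousOn j) c d).measurableSet
    have e : volume (levelBand (Φ j) c d) = halfLine (levelBand (Φ j) c d) := by
      rw [halfLine, Measure.restrict_apply hm, inter_eq_left.2 (show levelBand (Φ j) c d ⊆ Ioi 0 from inter_subset_left)]
    rw [e, ← measure_union' _ hm]
    · refine measure_mono (union_subset (fun x hx => le_of_lt hx.2.1) fun x hx => ?_)
      exact hcd.trans hx
    · refine Set.disjoint_left.2 fun x hx hx' => ?_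
      exact absurd hx.2.2 (not_lt.2 hx')
  have hle : ∑ j, volume (levelBand (Φ j) c d) + (N : ℝ≥0∞) * ENNReal.ofReal t₁ ≤
      (N : ℝ≥0∞) * ENNReal.ofReal t₂ :=
    (add_le_add_right (lt_levelMeasure_of_lt_profile hN hd).le _).trans
      (hsum.trans (levelMeasure_le_of_profile_lt hb hc))
  have hfin : ∑ j, volume (levelBand (Φ j) c d) < ⊤ :=
    (le_self_add.trans hle).trans_lt
      (ENNReal.mul_lt_top (ENNReal.natCast_lt_top N) ENNReal.ofReal_lt_top)
  have hj : ∀ j, volume (levelBand (Φ j) c d) < ⊤ :=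
    fun j => ENNReal.sum_lt_top.1 hfin j (Finset.mem_univ j)
  refine ⟨hj, ?_⟩
  have h := ENNReal.toReal_mono
    (ENNReal.mul_lt_top (ENNReal.natCast_lt_top N) ENNReal.ofReal_lt_top).ne hle
  rw [ENNReal.toReal_add hfin.ne
    (ENNReal.mul_lt_top (ENNReal.natCast_lt_top N) ENNReal.ofReal_lt_top).ne, ENNReal.toReal_mul,
    ENNReal.toReal_mul, ENNReal.toReal_ofReal h1, ENNReal.toReal_ofReal (h1.trans h12),
    ENNReal.toReal_sum fun j _ => (hj j).ne, ENNReal.toReal_natCast] at h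
  simp only [Measure.real]
  linarith

/-- The part of the energy carried by the points where `‖Φ‖ > g(t)`. -/
noncomputable def energyAbove (Φ v : Fin N → ℝ → E) (t : ℝ) : ℝ :=
  ∑ j, ∫ x in Ioi 0 ∩ (fun x => ‖Φ j x‖) ⁻¹' Ioi (profile Φ t), ‖v j x‖ ^ 2

omit [NormedSpace ℝ E] [CompleteSpace E] in
theorem integrableOn_sq_norm (hv : ∀ j, MemLp (v j) 2 halfLine) (j : Fin N) {S : Set ℝ}
    (hS : S ⊆ Ioi 0) : IntegrableOn (fun x => ‖v j x‖ ^ 2) S :=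
  IntegrableOn.mono_set (t := Ioi 0) ((hv j).integrable_norm_pow two_ne_zero) hS

omit [NormedSpace ℝ E] [CompleteSpace E] in
theorem energyAbove_nonneg (t : ℝ) : 0 ≤ energyAbove Φ v t :=
  Finset.sum_nonneg fun _ _ => integral_nonneg fun _ => sq_nonneg _

omit [NormedSpace ℝ E] [CompleteSpace E] in
theorem energyAbove_le (hv : ∀ j, MemLp (v j) 2 halfLine) (t : ℝ) :
    energyAbove Φ v t ≤ ∑ j, ∫ x, ‖v j x‖ ^ 2 ∂halfLine :=
  Finset.sum_le_sum fun j _ => setIntegral_mono_set ((hv j).integrable_norm_pow two_ne_zero)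
    (Eventually.of_forall fun _ => sq_nonneg _) inter_subset_left.eventuallyLE

omit [NormedSpace ℝ E] [CompleteSpace E] in
theorem energyAbove_monotone (hN : 1 ≤ N) (hv : ∀ j, MemLp (v j) 2 halfLine)
    (hb : ∀ t, BddAbove (profileSet Φ t)) : Monotone (energyAbove Φ v) := by
  intro s t hst
  refine Finset.sum_le_sum fun j _ => setIntegral_mono_set
    (integrableOn_sq_norm hv j inter_subset_left) (Eventually.of_forall fun _ => sq_nonneg _)
    (LE.le.eventuallyLE ?_)
  exact inter_subset_inter_right _ fun x hx => (profile_le_profile hN (hb s) hst).trans_lt hx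

omit [CompleteSpace E] in
theorem sum_integral_levelBand_le (hE : MemEnergy Φ) (hv : ∀ j, MemLp (v j) 2 halfLine)
    {t₁ t₂ c d : ℝ} (hc : profile Φ t₂ < c) (hd : d < profile Φ t₁) (hcd : c ≤ d) :
    ∑ j, ∫ x in levelBand (Φ j) c d, ‖v j x‖ ^ 2 ≤ energyAbove Φ v t₂ - energyAbove Φ v t₁ := by
  rw [le_sub_iff_add_le, energyAbove, energyAbove, ← Finset.sum_add_distrib]
  refine Finset.sum_le_sum fun j _ => ?_
  rw [← setIntegral_union]
  · refine setIntegral_mono_set (integrableOn_sq_norm hv j inter_subset_left)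
      (Eventually.of_forall fun _ => sq_nonneg _) (LE.le.eventuallyLE ?_)
    rintro x (hx | hx)
    · exact ⟨hx.1, hc.trans hx.2.1⟩
    · exact ⟨hx.1, hc.trans_le (hcd.trans (hd.le.trans (le_of_lt hx.2)))⟩
  · refine Set.disjoint_left.2 fun x hx hx' => ?_
    have h1 : ‖Φ j x‖ < d := hx.2.2
    have h2 : profile Φ t₁ < ‖Φ j x‖ := hx'.2
    linarith
  · exact (((hE.continuousOn j).norm.mono Ioi_subset_Ici_self).isOpen_inter_preimage isOpen_Ioi
      isOpen_Ioi).measurableSet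
  · exact integrableOn_sq_norm hv j inter_subset_left
  · exact integrableOn_sq_norm hv j inter_subset_left

theorem sq_profile_sub_le (hN : 1 ≤ N) (hE : MemEnergy Φ) (hw : ∀ j, HasWeakDeriv (Φ j) (v j))
    (hv : ∀ j, MemLp (v j) 2 halfLine) (hb : ∀ t, BddAbove (profileSet Φ t))
    {m : ℝ} (hm : m = 1 ∨ (m = 2 ∧ 2 ≤ N)) {s t : ℝ} (hs : 0 ≤ s) (hst : s ≤ t) :
    (profile Φ s - profile Φ t) ^ 2 ≤
      N / m ^ 2 * (t - s) * (energyAbove Φ v t - energyAbove Φ v s) := by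
  have hm0 : 0 < m := by rcases hm with rfl | ⟨rfl, _⟩ <;> norm_num
  have hmono := profile_le_profile hN (hb s) hst
  have hΔ : 0 ≤ energyAbove Φ v t - energyAbove Φ v s :=
    sub_nonneg.2 (energyAbove_monotone hN hv hb hst)
  set Δ := energyAbove Φ v t - energyAbove Φ v s
  rcases hst.eq_or_lt with rfl | hst'
  · simp
  have hL : 0 < (N : ℝ) * (t - s) := mul_pos (by exact_mod_cast hN) (sub_pos.2 hst')
  have key : ∀ c d, profile Φ t < c → d < profile Φ s → c ≤ d →
      (d - c) ^ 2 ≤ N / m ^ 2 * (t - s) * Δ := by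
    intro c d hc hd hcd
    obtain ⟨hfin, hvol⟩ := sum_volume_levelBand_le hN hE hs (hb t) hc hd hcd hst
    have hcross := mul_sub_le_sum_integral_levelBand hE hw hv hm hcd
      ((levelMeasure_le_of_profile_lt (hb t) hc).trans_lt
        (ENNReal.mul_lt_top (ENNReal.natCast_lt_top N) ENNReal.ofReal_lt_top))
      (zero_le.trans_lt (lt_levelMeasure_of_lt_profile hN hd))
    have hen := sum_integral_levelBand_le hE hv hc hd hcd
    -- Cauchy–Schwarz in the form 2θ|v| ≤ θ² + |v|², which handles all edges at once; this θ is the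
    -- optimal weight.
    set θ := m * (d - c) / (N * (t - s)) with hθ
    have hθ0 : 0 ≤ θ := div_nonneg (mul_nonneg hm0.le (sub_nonneg.2 hcd)) hL.le
    have hj : ∀ j, 2 * θ * ∫ x in levelBand (Φ j) c d, ‖v j x‖ ≤
        θ ^ 2 * volume.real (levelBand (Φ j) c d) +
          ∫ x in levelBand (Φ j) c d, ‖v j x‖ ^ 2 := by
      intro j
      have hf : IsFiniteMeasure (volume.restrict (levelBand (Φ j) c d)) :=
        ⟨by rw [Measure.restrict_apply_univ]; exact hfin j⟩
      have hLp : MemLp (v j) 2 (volume.restrict (levelBand (Φ j) c d)) :=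
        (hv j).mono_measure (Measure.restrict_mono inter_subset_left le_rfl)
      have hI2 := integrableOn_sq_norm hv j (S := levelBand (Φ j) c d) inter_subset_left
      have h1 : ∫ x in levelBand (Φ j) c d, 2 * θ * ‖v j x‖ ≤
          ∫ x in levelBand (Φ j) c d, (θ ^ 2 + ‖v j x‖ ^ 2) := by
        refine integral_mono ((hLp.integrable one_le_two).norm.const_mul _)
          ((integrable_const _).add hI2) fun x => ?_
        change 2 * θ * ‖v j x‖ ≤ θ ^ 2 + ‖v j x‖ ^ 2
        nlinarith [sq_nonneg (θ - ‖v j x‖)]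
      rw [integral_const_mul, integral_add (integrable_const _) hI2, setIntegral_const,
        smul_eq_mul, mul_comm (volume.real _)] at h1
      exact h1
    have hsum := Finset.sum_le_sum fun j (_ : j ∈ Finset.univ) => hj j
    rw [← Finset.mul_sum, Finset.sum_add_distrib, ← Finset.mul_sum] at hsum
    have hD : m * (d - c) = θ * (N * (t - s)) := by rw [hθ]; field_simp
    have h2 : 2 * θ * (m * (d - c)) ≤ θ ^ 2 * (N * (t - s)) + Δ := by
      calc _ ≤ 2 * θ * ∑ j, ∫ x in levelBand (Φ j) c d, ‖v j x‖ := by gcongr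
        _ ≤ _ := hsum
        _ ≤ _ := by gcongr
    have h3 : θ ^ 2 * (N * (t - s)) ≤ Δ := by
      rw [hD] at h2; nlinarith
    have h4 : (m * (d - c)) ^ 2 ≤ N * (t - s) * Δ := by
      rw [hD]
      calc (θ * (N * (t - s))) ^ 2 = N * (t - s) * (θ ^ 2 * (N * (t - s))) := by ring
        _ ≤ _ := by gcongr
    rw [div_mul_eq_mul_div, div_mul_eq_mul_div, le_div_iff₀ (by positivity)]
    linarith [mul_pow m (d - c) 2]
  have hR0 : 0 ≤ N / m ^ 2 * (t - s) * Δ :=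
    mul_nonneg (mul_nonneg (by positivity) (sub_nonneg.2 hst)) hΔ
  refine (Real.le_sqrt (sub_nonneg.2 hmono) hR0).1 ?_
  by_contra hcon
  push Not at hcon
  set R := √(N / m ^ 2 * (t - s) * Δ) with hR
  have hRn : 0 ≤ R := Real.sqrt_nonneg _
  -- A quarter of the supposed excess is removed at each end, so d - c is the mean of the gap and R,
  -- still larger than R.
  have := key (profile Φ t + (profile Φ s - profile Φ t - R) / 4)
    (profile Φ s - (profile Φ s - profile Φ t - R) / 4) (by linarith) (by linarith) (by linarith)
  have := Real.le_sqrt_of_sq_le this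
  linarith

end Energy

/-! ### The derivative of the rearrangement. -/

section PolyaSzego

variable {E : Type*} [NormedAddCommGroup E] {N : ℕ}

theorem graphNorm_two_sq (f : Fin N → ℝ → E) :
    graphNorm f 2 ^ 2 = ∑ j, ∫⁻ x, ‖f j x‖ₑ ^ 2 ∂halfLine := by
  have h : ∀ j, eLpNorm (f j) 2 halfLine ^ (2 : ℝ≥0∞).toReal =
      ∫⁻ x, ‖f j x‖ₑ ^ 2 ∂halfLine := by
    intro j
    rw [eLpNorm_eq_lintegral_rpow_enorm_toReal two_ne_zero ENNReal.ofNat_ne_top,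
      ← ENNReal.rpow_mul]
    simp
  rw [graphNorm, if_neg ENNReal.ofNat_ne_top]
  simp_rw [h]
  rw [← ENNReal.rpow_natCast, ← ENNReal.rpow_mul]
  simp

theorem graphNorm_congr_ae {f g : Fin N → ℝ → E} (h : ∀ j, f j =ᵐ[halfLine] g j) (p : ℝ≥0∞) :
    graphNorm f p = graphNorm g p := by
  simp only [graphNorm, fun j p => eLpNorm_congr_ae (p := p) (h j)]

variable [NormedSpace ℝ E] [CompleteSpace E] {Φ v : Fin N → ℝ → E}

theorem graphNorm_graphDeriv (hw : ∀ j, HasWeakDeriv (Φ j) (v j)) (p : ℝ≥0∞) :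
    graphNorm (graphDeriv Φ) p = graphNorm v p :=
  graphNorm_congr_ae (fun j => (hw j).weakDeriv_ae_eq) p

omit [NormedSpace ℝ E] [CompleteSpace E] in
theorem ofReal_sum_integral_sq_norm (hv : ∀ j, MemLp (v j) 2 halfLine) :
    ENNReal.ofReal (∑ j, ∫ x, ‖v j x‖ ^ 2 ∂halfLine) = graphNorm v 2 ^ 2 := by
  rw [graphNorm_two_sq, ENNReal.ofReal_sum_of_nonneg fun j _ => integral_nonneg fun _ => sq_nonneg _]
  refine Finset.sum_congr rfl fun j _ => ?_
  rw [ofReal_integral_eq_lintegral_ofReal ((hv j).integrable_norm_pow two_ne_zero)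
    (Eventually.of_forall fun _ => sq_nonneg _)]
  refine lintegral_congr fun x => ?_
  rw [ENNReal.ofReal_pow (norm_nonneg _), ofReal_norm]

/-- A single crossing (m = 1) is enough here, which covers N = 1. -/
theorem absolutelyContinuousOnInterval_profile (hN : 1 ≤ N) (hE : MemEnergy Φ) {R : ℝ}
    (hR : 0 ≤ R) : AbsolutelyContinuousOnInterval (profile Φ) 0 R := by
  obtain ⟨B, hB⟩ := exists_norm_le hE
  have hb := bddAbove_profileSet_of_bound hB
  choose v hw hv using fun j => (hE.memH1 j).2
  exact absolutelyContinuousOnInterval_of_sq_sub_le (K := N / 1 ^ 2) (by positivity)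
    (energyAbove_monotone hN hv hb) energyAbove_nonneg (energyAbove_le hv)
    (fun s t hs hst => sq_profile_sub_le hN hE hw hv hb (Or.inl rfl) hs hst) hR

theorem hasWeakDeriv_profile (hN : 1 ≤ N) (hE : MemEnergy Φ) :
    HasWeakDeriv (profile Φ) (deriv (profile Φ)) :=
  .of_absolutelyContinuous fun _ hR => absolutelyContinuousOnInterval_profile hN hE hR

theorem lintegral_enorm_deriv_profile_sq_le (hN : 1 ≤ N) (hE : MemEnergy Φ)
    (hw : ∀ j, HasWeakDeriv (Φ j) (v j)) (hv : ∀ j, MemLp (v j) 2 halfLine) {m : ℝ}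
    (hm : m = 1 ∨ (m = 2 ∧ 2 ≤ N)) :
    ∫⁻ x, ‖deriv (profile Φ) x‖ₑ ^ 2 ∂halfLine ≤
      ENNReal.ofReal (N / m ^ 2) * graphNorm v 2 ^ 2 := by
  obtain ⟨B, hB⟩ := exists_norm_le hE
  have hb := bddAbove_profileSet_of_bound hB
  rw [← ofReal_sum_integral_sq_norm hv, ← ENNReal.ofReal_mul (by positivity)]
  exact lintegral_enorm_deriv_sq_le (by positivity)
    (fun s t hst => profile_le_profile hN (hb s) hst)
    (energyAbove_monotone hN hv hb) energyAbove_nonneg (energyAbove_le hv)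
    (fun s t hs hst => sq_profile_sub_le hN hE hw hv hb hm hs hst)

theorem memLp_deriv_profile (hN : 1 ≤ N) (hE : MemEnergy Φ) :
    MemLp (deriv (profile Φ)) 2 halfLine := by
  choose v hw hv using fun j => (hE.memH1 j).2
  refine ⟨(measurable_deriv _).aestronglyMeasurable, ?_⟩
  rw [eLpNorm_lt_top_iff_lintegral_rpow_enorm_lt_top two_ne_zero ENNReal.ofNat_ne_top]
  have h := lintegral_enorm_deriv_profile_sq_le hN hE hw hv (Or.inl rfl)
  simp only [ENNReal.toReal_ofNat, ENNReal.rpow_ofNat]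
  refine h.trans_lt ?_
  rw [← ofReal_sum_integral_sq_norm hv, ← ENNReal.ofReal_mul (by positivity)]
  exact ENNReal.ofReal_lt_top

theorem continuousOn_profile (hN : 1 ≤ N) (hE : MemEnergy Φ) :
    ContinuousOn (profile Φ) (Ici 0) := by
  intro x hx
  have hx0 : 0 ≤ x := hx
  have h := (absolutelyContinuousOnInterval_profile hN hE (R := x + 1) (by linarith)).continuousOn
  rw [uIcc_of_le (by linarith)] at h
  refine (h x ⟨hx0, by linarith⟩).mono_of_mem_nhdsWithin ?_
  exact mem_nhdsWithin.2 ⟨Iio (x + 1), isOpen_Iio, mem_Iio.2 (by linarith),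
    fun y hy => ⟨hy.2, le_of_lt hy.1⟩⟩

theorem MemEnergy.rearrangement (hN : 1 ≤ N) (hE : MemEnergy Φ) :
    MemEnergy (rearrangement Φ) where
  memH1 j := ⟨memLpGraph_rearrangement hN one_le_two hE.memLpGraph j, deriv (profile Φ),
    hasWeakDeriv_profile hN hE, memLp_deriv_profile hN hE⟩
  continuousOn _ := continuousOn_profile hN hE
  vertex _ _ := rfl

theorem graphNorm_graphDeriv_rearrangement_sq (hN : 1 ≤ N) (hE : MemEnergy Φ) :
    graphNorm (graphDeriv (rearrangement Φ)) 2 ^ 2 =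
      N * ∫⁻ x, ‖deriv (profile Φ) x‖ₑ ^ 2 ∂halfLine := by
  rw [graphNorm_graphDeriv (Φ := rearrangement Φ) (v := fun _ => deriv (profile Φ))
    (fun _ => hasWeakDeriv_profile hN hE), graphNorm_two_sq, Finset.sum_const, Finset.card_univ,
    Fintype.card_fin, nsmul_eq_mul]

theorem graphNorm_graphDeriv_rearrangement_le (hN : 2 ≤ N) (hE : MemEnergy Φ) :
    graphNorm (graphDeriv (rearrangement Φ)) 2 ≤
      (N : ℝ≥0∞) / 2 * graphNorm (graphDeriv Φ) 2 := by
  have hN1 : 1 ≤ N := by omega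
  choose v hw hv using fun j => (hE.memH1 j).2
  rw [← ENNReal.pow_le_pow_left_iff two_ne_zero, graphNorm_graphDeriv_rearrangement_sq hN1 hE,
    graphNorm_graphDeriv hw, mul_pow]
  have h := lintegral_enorm_deriv_profile_sq_le hN1 hE hw hv (Or.inr ⟨rfl, hN⟩)
  have e : (N : ℝ≥0∞) * ENNReal.ofReal (N / 2 ^ 2) = ((N : ℝ≥0∞) / 2) ^ 2 := by
    have h2 : (N : ℝ≥0∞) / 2 = ENNReal.ofReal (N / 2) := by
      rw [ENNReal.ofReal_div_of_pos two_pos]; simp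
    rw [h2, ← ENNReal.ofReal_natCast, ← ENNReal.ofReal_mul (by positivity),
      ← ENNReal.ofReal_pow (by positivity)]
    congr 1
    ring
  rw [← e, mul_assoc]
  gcongr

end PolyaSzego

/-! ### Optimality of the constant. -/

section Tent

/-- The tent of height `1` over `[0, 2]`. -/
def tent (x : ℝ) : ℝ := max 0 (1 - |x - 1|)

/-- The tent on one edge of the star graph. -/
noncomputable def tentOn {N : ℕ} (i : Fin N) : Fin N → ℝ → ℂ :=
  fun j x => ((if j = i then tent x else 0 : ℝ) : ℂ)

theorem lipschitzWith_tent : LipschitzWith 1 tent := by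
  refine LipschitzWith.of_dist_le_mul fun x y => ?_
  simp only [tent, Real.dist_eq, NNReal.coe_one, one_mul]
  calc |max 0 (1 - |x - 1|) - max 0 (1 - |y - 1|)| ≤ |(1 - |x - 1|) - (1 - |y - 1|)| := by
        simpa [max_comm] using abs_max_sub_max_le_abs (1 - |x - 1|) (1 - |y - 1|) 0
    _ = |(|y - 1| - |x - 1|)| := by congr 1; ring
    _ ≤ |(y - 1) - (x - 1)| := abs_abs_sub_abs_le _ _
    _ = |x - y| := by rw [abs_sub_comm]; congr 1; ring

theorem tent_of_two_le {x : ℝ} (hx : 2 ≤ x) : tent x = 0 := by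
  rw [tent, abs_of_nonneg (by linarith), max_eq_left (by linarith)]

variable {τ : ℝ → ℝ}

theorem hasWeakDeriv_of_lipschitzWith (h : LipschitzWith 1 τ) :
    HasWeakDeriv (fun x => (τ x : ℂ)) (fun x => ((deriv τ x : ℝ) : ℂ)) :=
  (HasWeakDeriv.of_absolutelyContinuous fun _ _ =>
    h.lipschitzOnWith.absolutelyContinuousOnInterval).ofReal

theorem norm_deriv_le_indicator (h : LipschitzWith 1 τ) (h2 : ∀ x, 2 ≤ x → τ x = 0) {x : ℝ}
    (hx : 0 < x) : ‖((deriv τ x : ℝ) : ℂ)‖ ≤ (Ioc (0 : ℝ) 2).indicator (fun _ => (1 : ℝ)) x := by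
  rw [Complex.norm_real]
  by_cases hx2 : x ≤ 2
  · rw [indicator_of_mem (show x ∈ Ioc (0 : ℝ) 2 from ⟨hx, hx2⟩)]
    simpa using norm_deriv_le_of_lipschitz h (x₀ := x)
  · have : τ =ᶠ[𝓝 x] fun _ => 0 := by
      filter_upwards [lt_mem_nhds (not_le.1 hx2)] with y hy using h2 y hy.le
    rw [this.deriv_eq, deriv_const, norm_zero]
    exact indicator_nonneg (fun _ _ => zero_le_one) x

theorem memLp_of_norm_le_indicator {f : ℝ → ℂ} (hf : AEStronglyMeasurable f halfLine) (c : ℝ)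
    (h : ∀ x, 0 < x → ‖f x‖ ≤ (Ioc (0 : ℝ) 2).indicator (fun _ => c) x) :
    MemLp f 2 halfLine := by
  have hm : halfLine (Ioc (0 : ℝ) 2) ≠ ⊤ :=
    ((Measure.restrict_apply_le _ _).trans_lt measure_Ioc_lt_top).ne
  refine (memLp_indicator_const 2 measurableSet_Ioc c (Or.inr hm)).mono' hf ?_
  exact (ae_restrict_iff' measurableSet_Ioi).2 (Eventually.of_forall h)

theorem memLp_deriv_of_lipschitzWith (h : LipschitzWith 1 τ) (h2 : ∀ x, 2 ≤ x → τ x = 0) :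
    MemLp (fun x => ((deriv τ x : ℝ) : ℂ)) 2 halfLine :=
  memLp_of_norm_le_indicator
    (Complex.measurable_ofReal.comp (measurable_deriv τ)).aestronglyMeasurable 1
    fun _ hx => norm_deriv_le_indicator h h2 hx

theorem memH1_of_lipschitzWith (h : LipschitzWith 1 τ) (h2 : ∀ x, 2 ≤ x → τ x = 0) :
    MemH1 (fun x => (τ x : ℂ)) := by
  refine ⟨memLp_of_norm_le_indicator
    (Complex.continuous_ofReal.comp h.continuous).aestronglyMeasurable 2 fun x hx => ?_,
    _, hasWeakDeriv_of_lipschitzWith h, memLp_deriv_of_lipschitzWith h h2⟩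
  rw [Complex.norm_real]
  by_cases hx2 : x ≤ 2
  · rw [indicator_of_mem (show x ∈ Ioc (0 : ℝ) 2 from ⟨hx, hx2⟩)]
    have := h.dist_le_mul x 2
    rw [h2 2 le_rfl, dist_zero_right, NNReal.coe_one, one_mul, Real.dist_eq, abs_sub_comm,
      abs_of_nonneg (by linarith)] at this
    linarith
  · rw [h2 x (not_le.1 hx2).le, norm_zero]
    exact indicator_nonneg (fun _ _ => zero_le_two) x

theorem lintegral_enorm_deriv_sq_le_two (h : LipschitzWith 1 τ) (h2 : ∀ x, 2 ≤ x → τ x = 0) :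
    ∫⁻ x, ‖((deriv τ x : ℝ) : ℂ)‖ₑ ^ 2 ∂halfLine ≤ 2 := by
  calc ∫⁻ x, ‖((deriv τ x : ℝ) : ℂ)‖ₑ ^ 2 ∂halfLine
      ≤ ∫⁻ x, (Ioc (0 : ℝ) 2).indicator (fun _ => (1 : ℝ≥0∞)) x ∂halfLine := by
        refine setLIntegral_mono' measurableSet_Ioi fun x hx => ?_
        have := norm_deriv_le_indicator h h2 hx
        rw [← ofReal_norm]
        by_cases hx' : x ∈ Ioc (0 : ℝ) 2
        · rw [indicator_of_mem hx'] at this ⊢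
          exact pow_le_one₀ zero_le (ENNReal.ofReal_le_one.2 this)
        · rw [indicator_of_notMem hx'] at this ⊢
          rw [ENNReal.ofReal_of_nonpos this, zero_pow two_ne_zero]
    _ ≤ 2 := by
        rw [lintegral_indicator measurableSet_Ioc, setLIntegral_const, one_mul]
        refine (Measure.restrict_apply_le _ _).trans ?_
        simp

variable {N : ℕ}

theorem memEnergy_tentOn (i : Fin N) : MemEnergy (tentOn i) where
  memH1 j := by
    unfold tentOn
    split_ifs with hj
    · exact memH1_of_lipschitzWith lipschitzWith_tent fun x => tent_of_two_le
    · exact memH1_of_lipschitzWith (τ := fun _ => 0) (LipschitzWith.const' 0) fun _ _ => rfl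
  continuousOn j := by
    have := lipschitzWith_tent.continuous
    unfold tentOn
    split_ifs <;> fun_prop
  vertex j k := by simp [tentOn, tent]

theorem graphNorm_graphDeriv_tentOn_sq_le (i : Fin N) :
    graphNorm (graphDeriv (tentOn i)) 2 ^ 2 ≤ 2 := by
  have hw : ∀ j, HasWeakDeriv (tentOn i j) (fun x => if j = i then ((deriv tent x : ℝ) : ℂ) else 0) := by
    intro j
    unfold tentOn
    split_ifs with hj
    · exact hasWeakDeriv_of_lipschitzWith lipschitzWith_tent
    · simpa using hasWeakDeriv_of_lipschitzWith (τ := fun _ => 0) (LipschitzWith.const' 0)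
  rw [graphNorm_graphDeriv hw, graphNorm_two_sq, Finset.sum_eq_single i]
  · simpa using lintegral_enorm_deriv_sq_le_two lipschitzWith_tent fun x => tent_of_two_le
  · intro j _ hj
    simp [hj]
  · simp

theorem levelMeasure_tentOn_le (i : Fin N) {s : ℝ} (hs : 0 < s) :
    levelMeasure (tentOn i) s ≤ 2 := by
  rw [levelMeasure, Finset.sum_eq_single i]
  · rw [halfLine, Measure.restrict_apply' measurableSet_Ioi]
    have : {x | s ≤ ‖tentOn i i x‖} ∩ Ioi 0 ⊆ Ioc 0 2 := by
      refine fun x hx => ⟨hx.2, ?_⟩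
      by_contra h
      have h1 : s ≤ ‖tentOn i i x‖ := hx.1
      simp [tentOn, tent_of_two_le (not_le.1 h).le] at h1
      linarith
    exact (measure_mono this).trans (by simp)
  · intro j _ hj
    refine measure_mono_null (fun x hx => ?_) measure_empty
    have h1 : s ≤ ‖tentOn i j x‖ := hx
    simp [tentOn, hj] at h1
    linarith
  · simp

theorem levelMeasure_tentOn_pos (i : Fin N) {s : ℝ} (hs : s < 1) :
    0 < levelMeasure (tentOn i) s := by
  -- The descending side of the tent, where it equals 2 - x, already gives positive measure.
  have h1 : halfLine (Ioo 1 (2 - s)) = ENNReal.ofReal (1 - s) := by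
    rw [halfLine, Measure.restrict_apply measurableSet_Ioo,
      inter_eq_left.2 (Ioo_subset_Ioi_self.trans (Ioi_subset_Ioi zero_le_one)), Real.volume_Ioo]
    congr 1
    ring
  have h2 : 0 < halfLine (Ioo 1 (2 - s)) := by
    rw [h1, ENNReal.ofReal_pos]; linarith
  refine h2.trans_le (le_trans (measure_mono fun x hx => ?_) (Finset.single_le_sum
    (f := fun j => halfLine {x | s ≤ ‖tentOn i j x‖}) (fun _ _ => zero_le) (Finset.mem_univ i)))
  change s ≤ ‖tentOn i i x‖
  simp only [tentOn, if_true, Complex.norm_real]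
  refine le_trans ?_ (le_abs_self _)
  refine le_trans ?_ (le_max_right _ _)
  rw [abs_of_pos (sub_pos.2 hx.1)]
  linarith [hx.2]

theorem one_le_profile_tentOn (i : Fin N) : 1 ≤ profile (tentOn i) 0 := by
  obtain ⟨B, hB⟩ := exists_norm_le (memEnergy_tentOn i)
  by_contra h
  obtain ⟨s, hs1, hs2⟩ := exists_between (not_le.1 h)
  have hs : s ∈ profileSet (tentOn i) 0 := by
    rw [mem_profileSet]
    simpa using levelMeasure_tentOn_pos i hs2
  exact absurd (le_csSup (bddAbove_profileSet_of_bound hB 0) hs) (not_le.2 hs1)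

theorem profile_tentOn_le (hN : 1 ≤ N) (i : Fin N) : profile (tentOn i) (2 / N) ≤ 0 := by
  refine csSup_le ⟨0, mem_profileSet_of_nonpos hN _ _ le_rfl⟩ fun s hs => ?_
  by_contra h
  refine absurd (mem_profileSet.1 hs) (not_lt.2 ?_)
  refine (levelMeasure_tentOn_le i (not_le.1 h)).trans (le_of_eq ?_)
  have : (N : ℝ) ≠ 0 := by positivity
  rw [← ENNReal.ofReal_natCast, ← ENNReal.ofReal_mul N.cast_nonneg, mul_div_cancel₀ _ this]
  simp

/-- The profile drops by at least 1 over a length 2/N. Integrating N|w| ≤ (N/2)² + |w|², whose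
weight N/2 is the mean slope of that drop, gives N ≤ N/2 + ∫ |w|². -/
theorem le_lintegral_enorm_deriv_profile_tentOn (hN : 1 ≤ N) (i : Fin N) :
    (N : ℝ≥0∞) / 2 ≤ ∫⁻ x, ‖deriv (profile (tentOn i)) x‖ₑ ^ 2 ∂halfLine := by
  have hE := memEnergy_tentOn i
  have hN0 : (0 : ℝ) < N := by positivity
  have hv := memLp_deriv_profile hN hE
  set w := deriv (profile (tentOn i))
  have h := (hasWeakDeriv_profile hN hE).norm_sub_le (continuousOn_profile hN hE) hv
    le_rfl (show (0 : ℝ) ≤ 2 / N by positivity)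
  have h1 : 1 ≤ ∫ x in Ioc 0 (2 / N : ℝ), ‖w x‖ := by
    refine le_trans ?_ h
    rw [Real.norm_eq_abs, abs_sub_comm]
    have := one_le_profile_tentOn i
    have := profile_tentOn_le hN i
    exact le_trans (by linarith) (le_abs_self _)
  have hsq : Integrable (fun x => ‖w x‖ ^ 2) halfLine := hv.integrable_norm_pow two_ne_zero
  have hi2 : IntegrableOn (fun x => ‖w x‖ ^ 2) (Ioc 0 (2 / N : ℝ)) :=
    IntegrableOn.mono_set hsq Ioc_subset_Ioi_self
  have h2 : ∫ x in Ioc 0 (2 / N : ℝ), N * ‖w x‖ ≤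
      ∫ x in Ioc 0 (2 / N : ℝ), (((N : ℝ) / 2) ^ 2 + ‖w x‖ ^ 2) := by
    refine integral_mono ((integrableOn_Ioc_of_memLp hv _).norm.const_mul _)
      ((integrable_const _).add hi2) fun x => ?_
    change (N : ℝ) * ‖w x‖ ≤ ((N : ℝ) / 2) ^ 2 + ‖w x‖ ^ 2
    nlinarith [sq_nonneg ((N : ℝ) / 2 - ‖w x‖)]
  rw [integral_const_mul, integral_add (integrable_const _) hi2, setIntegral_const, smul_eq_mul,
    Real.volume_real_Ioc_of_le (by positivity)] at h2
  have h3 : (2 / (N : ℝ) - 0) * ((N : ℝ) / 2) ^ 2 = N / 2 := by field_simp; ring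
  have h4 : ∫ x in Ioc 0 (2 / N : ℝ), ‖w x‖ ^ 2 ≤ ∫ x, ‖w x‖ ^ 2 ∂halfLine :=
    setIntegral_mono_set hsq (Eventually.of_forall fun _ => sq_nonneg _)
      (LE.le.eventuallyLE Ioc_subset_Ioi_self)
  have h5 : (N : ℝ) / 2 ≤ ∫ x, ‖w x‖ ^ 2 ∂halfLine := by nlinarith
  have h6 := ENNReal.ofReal_le_ofReal h5
  rw [ofReal_integral_eq_lintegral_ofReal hsq (Eventually.of_forall fun _ => sq_nonneg _),
    ENNReal.ofReal_div_of_pos two_pos, ENNReal.ofReal_natCast, ENNReal.ofReal_ofNat] at h6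
  refine h6.trans_eq (lintegral_congr fun x => ?_)
  rw [ENNReal.ofReal_pow (norm_nonneg _), ofReal_norm]

theorem half_card_le_of_forall_graphNorm_le (hN : 1 ≤ N) {C : ℝ≥0∞}
    (hC : ∀ Φ : Fin N → ℝ → ℂ, MemEnergy Φ →
      graphNorm (graphDeriv (rearrangement Φ)) 2 ≤ C * graphNorm (graphDeriv Φ) 2) :
    (N : ℝ≥0∞) / 2 ≤ C := by
  set i : Fin N := ⟨0, hN⟩
  have hE := memEnergy_tentOn i
  rw [← ENNReal.pow_le_pow_left_iff two_ne_zero]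
  have h1 := (ENNReal.pow_le_pow_left_iff two_ne_zero).2 (hC _ hE)
  rw [graphNorm_graphDeriv_rearrangement_sq hN hE, mul_pow] at h1
  have h2 : (N : ℝ≥0∞) * (N / 2) ≤ C ^ 2 * 2 :=
    (mul_le_mul_right (le_lintegral_enorm_deriv_profile_tentOn hN i) _).trans
      (h1.trans (mul_le_mul_right (graphNorm_graphDeriv_tentOn_sq_le i) _))
  have e : (N : ℝ≥0∞) * (N / 2) = (N / 2) ^ 2 * 2 := by
    rw [sq, mul_assoc, ENNReal.div_mul_cancel two_ne_zero ENNReal.ofNat_ne_top, mul_comm]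
  rw [e] at h2
  exact (ENNReal.mul_le_mul_iff_left two_ne_zero ENNReal.ofNat_ne_top).1 h2

end Tent

end StarGraph

theorem theoremA1 (N : ℕ) (hN : 1 ≤ N) :
    -- `Φ*` is nonnegative, symmetric and nonincreasing, and has the same `L^p` norm as `Φ`
    (∀ p : ℝ≥0∞, 1 ≤ p → ∀ Φ : Fin N → ℝ → ℂ, StarGraph.MemLpGraph Φ p →
      (∀ j, ∀ x, 0 ≤ x → 0 ≤ StarGraph.rearrangement Φ j x) ∧
      (∀ i j, StarGraph.rearrangement Φ i = StarGraph.rearrangement Φ j) ∧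
      (∀ j, AntitoneOn (StarGraph.rearrangement Φ j) (Ioi 0)) ∧
      StarGraph.MemLpGraph (StarGraph.rearrangement Φ) p ∧
      StarGraph.graphNorm (StarGraph.rearrangement Φ) p = StarGraph.graphNorm Φ p) ∧
    -- the energy space is preserved
    (∀ Φ : Fin N → ℝ → ℂ, StarGraph.MemEnergy Φ →
      StarGraph.MemEnergy (StarGraph.rearrangement Φ)) ∧
    -- the inequality, and the optimality of its constant
    (2 ≤ N →
      (∀ Φ : Fin N → ℝ → ℂ, StarGraph.MemEnergy Φ →
        StarGraph.graphNorm (StarGraph.graphDeriv (StarGraph.rearrangement Φ)) 2 ≤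
          (N : ℝ≥0∞) / 2 * StarGraph.graphNorm (StarGraph.graphDeriv Φ) 2) ∧
      (∀ C : ℝ≥0∞,
        (∀ Φ : Fin N → ℝ → ℂ, StarGraph.MemEnergy Φ →
          StarGraph.graphNorm (StarGraph.graphDeriv (StarGraph.rearrangement Φ)) 2 ≤
            C * StarGraph.graphNorm (StarGraph.graphDeriv Φ) 2) →
        (N : ℝ≥0∞) / 2 ≤ C)) := by
  refine ⟨fun p hp Φ hΦ => ⟨fun _ x _ => StarGraph.profile_nonneg hN Φ x, fun _ _ => rfl,
    fun _ => StarGraph.antitoneOn_profile hN fun _ => StarGraph.bddAbove_profileSet hN hp hΦ,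
    StarGraph.memLpGraph_rearrangement hN hp hΦ, StarGraph.graphNorm_rearrangement hN hp hΦ⟩,
    fun _ hΦ => hΦ.rearrangement hN, fun hN2 => ⟨fun _ hΦ => ?_, fun _ hC => ?_⟩⟩
  · exact StarGraph.graphNorm_graphDeriv_rearrangement_le hN2 hΦ
  · exact StarGraph.half_card_le_of_forall_graphNorm_le hN hC
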